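/- **Model.** Let $A\in\mathbb{R}_{\ge 0}^{n\times m}$, let $Y_1,\dots,Y_m$ be independent nonnegative random variables, and let $X=AY$, i.e. $X_i=\sum_{j}A_{ij}Y_j$. We say that $A$ has column sparsity (at most) $s_{\mathrm{col}}$ if every column of $A$ has at most $s_{\mathrm{col}}$ nonzero entries. A (possibly randomized) online algorithm with cardinality constraint $r$ is given $A$ and the distributions of $Y_1,\dots,Y_m$, observes $X_1,\dots,X_n$ one at a time (but not the $Y_j$), and, upon observing $X_i$, irrevocably accepts or rejects it, knowing only $X_1,\dots,X_i$ and its own internal randomness (independent of $Y$), subject to accepting at most $r$ values in total. If $Q$ is the set of accepted indices, then $\mathrm{ALG}=\sum_{i\in Q}X_i$, while $\mathrm{OPT}=\sum_{k=1}^{r}X^{(k)}$, where $X^{(k)}$ is the $k$-th largest of $X_1,\dots,X_n$ (and $X^{(k)}=0$ for $k>n$). The linearly correlated prophets problem with column sparsity $s_{\mathrm{col}}$ and cardinality constraint $r$ *admits an $\alpha$-approximation* if for all $n,m$, all such $A$ of column sparsity at most $s_{\mathrm{col}}$ and all distributions of $Y_1,\dots,Y_m$ there is such an algorithm with $\mathbb{E}[\mathrm{ALG}]\ge\frac1\alpha\,\mathbb{E}[\mathrm{OPT}]$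 (expectations in $[0,\infty]$). **Theorem.** There is an absolute constant $C>0$ such that for all integers $s_{\mathrm{col}}\ge 0$ and $r\ge\max\{2,s_{\mathrm{col}}\}$, the linearly correlated prophets problem with column sparsity $s_{\mathrm{col}}$ and cardinality constraint $r$ admits a $$\Big(1+C\,\big(\tfrac{s_{\mathrm{col}}}{r}\big)^{1/5}(\log r)^{6/5}\Big)\text{-approximation}.$$ In particular, for every fixed $s_{\mathrm{col}}$ the approximation ratio tends to $1$ as $r\to\infty$. -/

import Mathlib

open MeasureTheory Filter Topology
open scoped NNReal ENNReal

noncomputable section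

namespace LinProphet

/-- Column sparsity of a matrix: the maximum number of nonzero entries in a column
(`0` if there are no columns). -/
def colSparsity {n m : ℕ} (A : Matrix (Fin n) (Fin m) ℝ≥0) : ℕ :=
  Finset.univ.sup fun j : Fin m => (Finset.univ.filter fun i : Fin n => A i j ≠ 0).card

/-- `x^{(1)} + ⋯ + x^{(r)}`, where `x^{(k)}` is the `k`-th largest of `x 0, …, x (n-1)`
(all the values are summed if `n ≤ r`). -/
def opt {n : ℕ} (r : ℕ) (x : Fin n → ℝ≥0) : ℝ≥0 :=
  (((List.ofFn x).mergeSort (fun a b => decide (b ≤ a))).take r).sum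

/-- A randomized online algorithm for arrivals `x 0, …, x (n-1)` under the cardinality
constraint `r`. A seed is drawn from `seedLaw` before the first arrival; `select ω x` is the set of
arrivals that are accepted. Whether arrival `i` is accepted depends only on the seed and on the
values `x k`, `k ≤ i`, seen so far, and it is a measurable function of these. -/
structure OnlineAlgorithm (n r : ℕ) where
  Seed : Type
  seedSpace : MeasurableSpace Seed
  seedLaw : Measure Seed
  seedLaw_prob : IsProbabilityMeasure seedLaw
  select : Seed → (Fin n → ℝ≥0) → Finset (Fin n)
  select_online : ∀ (ω : Seed) (i : Fin n) (x x' : Fin n → ℝ≥0),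
    (∀ k, k ≤ i → x k = x' k) → (i ∈ select ω x ↔ i ∈ select ω x')
  select_measurable : ∀ i : Fin n,
    MeasurableSet {p : Seed × (Fin n → ℝ≥0) | i ∈ select p.1 p.2}
  select_card : ∀ (ω : Seed) (x : Fin n → ℝ≥0), (select ω x).card ≤ r

attribute [instance] OnlineAlgorithm.seedSpace OnlineAlgorithm.seedLaw_prob

/-- The expected reward `𝔼[ALG]` of an algorithm on the arrivals `X = A Y`, where the `Y j` are
independent with laws `μ j`, and the seed is independent of `Y`. -/
def expectedReward {n m r : ℕ} (alg : OnlineAlgorithm n r) (A : Matrix (Fin n) (Fin m) ℝ≥0)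
    (μ : Fin m → Measure ℝ≥0) : ℝ≥0∞ :=
  ∫⁻ ω, ∫⁻ y, ((∑ i ∈ alg.select ω (A.mulVec y), A.mulVec y i : ℝ≥0) : ℝ≥0∞)
    ∂(Measure.pi μ) ∂alg.seedLaw

/-- The prophet's expected reward `𝔼[OPT]`, where `OPT` is the sum of the `r` largest entries
of `X = A Y` and the `Y j` are independent with laws `μ j`. -/
def expectedOpt {n m : ℕ} (r : ℕ) (A : Matrix (Fin n) (Fin m) ℝ≥0)
    (μ : Fin m → Measure ℝ≥0) : ℝ≥0∞ :=
  ∫⁻ y, (opt r (A.mulVec y) : ℝ≥0∞) ∂(Measure.pi μ)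

/-- The linearly correlated prophets problem with column sparsity `s` and cardinality
constraint `r` admits an `α`-approximation: for every number of arrivals and of features, every
nonnegative matrix with at most `s` nonzero entries per column and all laws of the features, there
is an online algorithm (which may depend on the matrix and on the laws) with
`𝔼[ALG] ≥ (1 / α) 𝔼[OPT]`. -/
def AdmitsApproximation (s r : ℕ) (α : ℝ) : Prop :=
  ∀ (n m : ℕ) (A : Matrix (Fin n) (Fin m) ℝ≥0) (μ : Fin m → Measure ℝ≥0),
    (∀ j, IsProbabilityMeasure (μ j)) → colSparsity A ≤ s →
      ∃ alg : OnlineAlgorithm n r,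
        ENNReal.ofReal (1 / α) * expectedOpt r A μ ≤ expectedReward alg A μ

/-- The ratio `1 + C (s / r)^{1/5} (log r)^{6/5}`. -/
def approxRatio (C : ℝ) (s r : ℕ) : ℝ :=
  1 + C * (((s : ℝ) / (r : ℝ)) ^ (1 / 5 : ℝ) * (Real.log r) ^ (6 / 5 : ℝ))

end LinProphet

end

/-!
For every threshold `τ` the prophet collects at most the benchmark `r τ + ∑ i, 𝔼[(X i - τ)⁺]`. The
algorithm accepts the first `r` arrivals above `τ` (the *candidates*; some arrivals may also be
candidates when they are equal to `τ`), where `τ` makes the expected number of candidates about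
`(1 - 2 u) r` with `u = (s / r) ^ (1 / 3)`. A feature influences at most `s` arrivals, so the number
of candidates has variance at most `s` times its mean, and with probability at least `1 - u` it
does not exceed `r - s`.

What remains is to see that little value is lost on the rare event that the budget runs out. The
value of a candidate is split into the *shares* of its features and a *rest*. If the arrival is a
candidate with probability at least `1 / 4`, then its whole value is shared among the features;
otherwise a feature only has a share if its contribution exceeds `τ` on its own. The share of
feature `j` is lost only if more than `r - s` of the arrivals *not* influenced by `j` are
candidates, an event that is independent of `j`, so a fraction `u` of the shares is lost. The rest
is a sum of contributions at most `τ` that is above `τ` with probability at most `1 / 4`; restarting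
the sum when it first exceeds a level shows that its second moment is `O(τ²)` times the probability
of being a candidate. Hence the total rest has a small variance, and little of it sits on a rare
event. This gives the ratio `1 + O(u)` for small `u`.

For large `u` a constant ratio suffices, and the same splitting gives one with the threshold at
which `r / 8` candidates are expected, if the algorithm also restricts itself to a uniformly
random set of arrivals: a given candidate is in this set while at most half of the other arrivals
influenced by feature `j` are with probability at least `1 / 4`.
-/

noncomputable section

namespace LinProphet

open ProbabilityTheory

/-! ### Functions of independent coordinates -/

section Independence

variable {ι : Type*} [Fintype ι] {Ω : ι → Type*} [∀ i, MeasurableSpace (Ω i)]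
  (μ : ∀ i, Measure (Ω i)) [∀ i, IsProbabilityMeasure (μ i)]

lemma indepFun_of_dependsOn {β γ : Type*} [MeasurableSpace β] [MeasurableSpace γ]
    {f : (∀ i, Ω i) → β} {g : (∀ i, Ω i) → γ} (hf : Measurable f) (hg : Measurable g)
    {S T : Finset ι} (hfS : DependsOn f S) (hgT : DependsOn g T) (hST : Disjoint S T) :
    IndepFun f g (Measure.pi μ) := by
  classical
  have y₀ : ∀ i, Ω i := fun i => ((μ i).nonempty_of_neZero).some
  have hf_restrict : f = (fun z => f (Function.updateFinset y₀ S z)) ∘ S.restrict :=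
    funext fun y => hfS fun i hi => by simp [Function.updateFinset, Finset.mem_coe.1 hi]
  have hg_restrict : g = (fun z => g (Function.updateFinset y₀ T z)) ∘ T.restrict :=
    funext fun y => hgT fun i hi => by simp [Function.updateFinset, Finset.mem_coe.1 hi]
  have hindep := (iIndepFun_pi (μ := μ) (X := fun _ => id) fun _ =>
    aemeasurable_id).indepFun_finset S T hST fun i => measurable_pi_apply i
  rw [hf_restrict, hg_restrict]
  exact hindep.comp (hf.comp measurable_updateFinset) (hg.comp measurable_updateFinset)

lemma setIntegral_eq_mul_of_dependsOn {f : (∀ i, Ω i) → ℝ} (hf : Measurable f)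
    {K : Set (∀ i, Ω i)} (hK : MeasurableSet K) {S T : Finset ι} (hfS : DependsOn f S)
    (hKT : DependsOn (· ∈ K) (T : Set ι)) (hST : Disjoint S T) :
    ∫ y in K, f y ∂Measure.pi μ
      = (Measure.pi μ).real K * ∫ y, f y ∂Measure.pi μ := by
  have hind : DependsOn (K.indicator (1 : (∀ i, Ω i) → ℝ)) T := fun y y' h => by
    have hyy' : (y ∈ K) = (y' ∈ K) := hKT h
    by_cases hy : y ∈ K
    · simp [hy, hyy' ▸ hy]
    · simp [hy, show y' ∉ K from hyy' ▸ hy]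
  have hmeas : Measurable (K.indicator (1 : (∀ i, Ω i) → ℝ)) := measurable_one.indicator hK
  have hindep := indepFun_of_dependsOn μ hmeas hf hind hfS hST.symm
  rw [← integral_indicator_one hK, ← integral_indicator hK,
    ← hindep.integral_fun_mul_eq_mul_integral hmeas.aestronglyMeasurable hf.aestronglyMeasurable]
  congr with y
  by_cases hy : y ∈ K <;> simp [hy]

end Independence

/-! ### The variance of a sum of sparsely dependent functions -/

section Variance

lemma variance_sum_le_card_mul {Ω κ : Type*} [MeasurableSpace Ω] {P : Measure Ω}
    [IsProbabilityMeasure P] (J : Finset κ) {X : κ → Ω → ℝ} (hX : ∀ i ∈ J, MemLp (X i) 2 P) :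
    Var[fun ω => ∑ i ∈ J, X i ω; P] ≤ J.card * ∑ i ∈ J, Var[X i; P] := by
  have hint : ∀ i ∈ J, Integrable (X i) P := fun i hi => (hX i hi).integrable one_le_two
  have hsq : ∀ i ∈ J, Integrable (fun ω => (X i ω - ∫ ω', X i ω' ∂P) ^ 2) P := fun i hi =>
    ((hX i hi).sub (memLp_const _)).integrable_sq
  rw [variance_eq_integral (memLp_finsetSum J hX).aemeasurable]
  calc ∫ ω, (∑ i ∈ J, X i ω - ∫ ω', ∑ i ∈ J, X i ω' ∂P) ^ 2 ∂P
      = ∫ ω, (∑ i ∈ J, (X i ω - ∫ ω', X i ω' ∂P)) ^ 2 ∂P := by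
        simp only [integral_finsetSum J hint, Finset.sum_sub_distrib]
    _ ≤ ∫ ω, J.card * ∑ i ∈ J, (X i ω - ∫ ω', X i ω' ∂P) ^ 2 ∂P :=
        integral_mono_of_nonneg (ae_of_all _ fun _ => sq_nonneg _)
          ((integrable_finsetSum J hsq).const_mul _)
          (ae_of_all _ fun _ => sq_sum_le_card_mul_sum_sq)
    _ = J.card * ∑ i ∈ J, Var[X i; P] := by
        rw [integral_const_mul, integral_finsetSum J hsq]
        congr 1
        exact Finset.sum_congr rfl fun i hi => (variance_eq_integral (hX i hi).aemeasurable).symm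

lemma variance_sum_le_card_mul_of_const {Ω κ : Type*} [MeasurableSpace Ω] {P : Measure Ω}
    [IsProbabilityMeasure P] {J' J : Finset κ} (hJ : J' ⊆ J) {X : κ → Ω → ℝ}
    (hX : ∀ i ∈ J, MemLp (X i) 2 P) (hconst : ∀ i ∈ J, i ∉ J' → ∃ c, ∀ ω, X i ω = c) :
    Var[fun ω => ∑ i ∈ J, X i ω; P] ≤ J'.card * ∑ i ∈ J, Var[X i; P] := by
  classical
  choose! c hc using hconst
  have hsum : (fun ω => ∑ i ∈ J, X i ω) = fun ω => ∑ i ∈ J', X i ω + ∑ i ∈ J \ J', c i := by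
    funext ω
    rw [← Finset.sum_sdiff hJ, add_comm]
    exact congrArg _ (Finset.sum_congr rfl fun i hi =>
      hc i (Finset.mem_sdiff.1 hi).1 (Finset.mem_sdiff.1 hi).2 ω)
  have hJ' : ∀ i ∈ J', MemLp (X i) 2 P := fun i hi => hX i (hJ hi)
  rw [hsum, variance_add_const (memLp_finsetSum J' hJ').aestronglyMeasurable]
  exact (variance_sum_le_card_mul J' hJ').trans (mul_le_mul_of_nonneg_left
    (Finset.sum_le_sum_of_subset_of_nonneg hJ fun i _ _ => variance_nonneg _ _) J'.card.cast_nonneg)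

variable {Ω Ω' : Type*} [MeasurableSpace Ω] [MeasurableSpace Ω'] {P : Measure Ω} {Q : Measure Ω'}
  [IsProbabilityMeasure P] [IsProbabilityMeasure Q] {f : Ω × Ω' → ℝ}

lemma ae_memLp_two_section (hf : MemLp f 2 (P.prod Q)) :
    ∀ᵐ x ∂P, MemLp (fun y => f (x, y)) 2 Q := by
  filter_upwards [hf.aestronglyMeasurable.prodMk_left, hf.integrable_sq.prod_right_ae]
    with x hx hx2
  exact (memLp_two_iff_integrable_sq hx).2 hx2

lemma ae_integral_section_sq_le (hf : MemLp f 2 (P.prod Q)) :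
    ∀ᵐ x ∂P, (∫ y, f (x, y) ∂Q) ^ 2 ≤ ∫ y, f (x, y) ^ 2 ∂Q := by
  filter_upwards [ae_memLp_two_section hf] with x hx
  have h := variance_nonneg (fun y => f (x, y)) Q
  rw [variance_eq_sub hx] at h
  simpa using h

lemma memLp_two_integral_section (hf : MemLp f 2 (P.prod Q)) :
    MemLp (fun x => ∫ y, f (x, y) ∂Q) 2 P := by
  have hmeas := hf.aestronglyMeasurable.integral_prod_right'
  refine (memLp_two_iff_integrable_sq hmeas).2 ?_
  refine hf.integrable_sq.integral_prod_left.mono' (hmeas.pow 2) ?_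
  filter_upwards [ae_integral_section_sq_le hf] with x hx
  rwa [Real.norm_of_nonneg (sq_nonneg _)]

lemma ae_variance_section_eq_sub (hf : MemLp f 2 (P.prod Q)) :
    (fun x => Var[fun y => f (x, y); Q])
      =ᵐ[P] fun x => ∫ y, f (x, y) ^ 2 ∂Q - (∫ y, f (x, y) ∂Q) ^ 2 := by
  filter_upwards [ae_memLp_two_section hf] with x hx
  simp [variance_eq_sub hx]

lemma integrable_variance_section (hf : MemLp f 2 (P.prod Q)) :
    Integrable (fun x => Var[fun y => f (x, y); Q]) P :=
  (integrable_congr (ae_variance_section_eq_sub hf)).2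
    (hf.integrable_sq.integral_prod_left.sub (memLp_two_integral_section hf).integrable_sq)

lemma variance_prod (hf : MemLp f 2 (P.prod Q)) :
    Var[f; P.prod Q]
      = ∫ x, Var[fun y => f (x, y); Q] ∂P + Var[fun x => ∫ y, f (x, y) ∂Q; P] := by
  have hsq := hf.integrable_sq
  have hmean := memLp_two_integral_section hf
  rw [variance_eq_sub hf, variance_eq_sub hmean,
    integral_congr_ae (ae_variance_section_eq_sub hf),
    integral_sub hsq.integral_prod_left hmean.integrable_sq,
    integral_prod f (hf.integrable one_le_two)]
  simp only [Pi.pow_apply]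
  rw [integral_prod _ hsq]
  ring

lemma variance_sum_prod_le {κ : Type*} {J : Finset κ} {f : κ → Ω × Ω' → ℝ} {c : ℝ}
    (hf : ∀ i ∈ J, MemLp (f i) 2 (P.prod Q))
    (hsection : ∀ᵐ x ∂P, Var[fun y => ∑ i ∈ J, f i (x, y); Q]
      ≤ c * ∑ i ∈ J, Var[fun y => f i (x, y); Q])
    (hmean : Var[fun x => ∑ i ∈ J, ∫ y, f i (x, y) ∂Q; P]
      ≤ c * ∑ i ∈ J, Var[fun x => ∫ y, f i (x, y) ∂Q; P]) :
    Var[fun p => ∑ i ∈ J, f i p; P.prod Q] ≤ c * ∑ i ∈ J, Var[f i; P.prod Q] := by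
  have hint : ∀ i ∈ J, Integrable (fun x => Var[fun y => f i (x, y); Q]) P := fun i hi =>
    integrable_variance_section (hf i hi)
  have hae : ∀ᵐ x ∂P, ∀ i ∈ J, MemLp (fun y => f i (x, y)) 2 Q :=
    (ae_ball_iff J.countable_toSet).2 fun i hi => ae_memLp_two_section (hf i hi)
  have hsum : MemLp (fun p => ∑ i ∈ J, f i p) 2 (P.prod Q) := memLp_finsetSum J hf
  have hswap : (fun x => ∫ y, ∑ i ∈ J, f i (x, y) ∂Q)
      =ᵐ[P] fun x => ∑ i ∈ J, ∫ y, f i (x, y) ∂Q :=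
    hae.mono fun x hx => integral_finsetSum J fun i hi => (hx i hi).integrable one_le_two
  have hsection_int : Integrable (fun x => Var[fun y => ∑ i ∈ J, f i (x, y); Q]) P :=
    integrable_variance_section (f := fun p => ∑ i ∈ J, f i p) hsum
  have hsections_int : Integrable (fun x => ∑ i ∈ J, Var[fun y => f i (x, y); Q]) P :=
    integrable_finsetSum J hint
  have hle : ∫ x, Var[fun y => ∑ i ∈ J, f i (x, y); Q] ∂P
      ≤ c * ∑ i ∈ J, ∫ x, Var[fun y => f i (x, y); Q] ∂P := by
    rw [← integral_finsetSum J hint, ← integral_const_mul]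
    exact integral_mono_ae hsection_int (hsections_int.const_mul c) hsection
  have hvar : ∑ i ∈ J, Var[f i; P.prod Q] = ∑ i ∈ J, ∫ x, Var[fun y => f i (x, y); Q] ∂P
      + ∑ i ∈ J, Var[fun x => ∫ y, f i (x, y) ∂Q; P] := by
    rw [← Finset.sum_add_distrib]
    exact Finset.sum_congr rfl fun i hi => variance_prod (hf i hi)
  rw [variance_prod hsum, variance_congr hswap, hvar, mul_add]
  exact add_le_add hle hmean

end Variance

section SparseVariance

variable {κ α : Type*} [MeasurableSpace α]

lemma measurePreserving_cons {m : ℕ} (μ : Fin (m + 1) → Measure α)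
    [∀ j, IsProbabilityMeasure (μ j)] :
    MeasurePreserving (fun p : α × (Fin m → α) => (Fin.cons p.1 p.2 : Fin (m + 1) → α))
      ((μ 0).prod (Measure.pi fun j => μ j.succ)) (Measure.pi μ) := by
  convert (measurePreserving_piFinSuccAbove μ 0).symm using 1
  · funext p
    simp [MeasurableEquiv.piFinSuccAbove_symm_apply, Fin.insertNthEquiv]
  · simp only [Fin.zero_succAbove]

/-- Induction over the coordinates by the law of total variance: the conditional variance given the
first coordinate is controlled by the induction hypothesis, and only the `f i` that depend on the
first coordinate contribute to the variance of the conditional expectation. -/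
theorem variance_sum_le_of_dependsOn {m : ℕ} (μ : Fin m → Measure α)
    [∀ j, IsProbabilityMeasure (μ j)] (J : Finset κ) (S : κ → Finset (Fin m)) {s : ℕ}
    (hs : ∀ j, (J.filter fun i => j ∈ S i).card ≤ s) {f : κ → (Fin m → α) → ℝ}
    (hf : ∀ i ∈ J, MemLp (f i) 2 (Measure.pi μ)) (hfS : ∀ i ∈ J, DependsOn (f i) (S i)) :
    Var[fun y => ∑ i ∈ J, f i y; Measure.pi μ] ≤ s * ∑ i ∈ J, Var[f i; Measure.pi μ] := by
  induction m with
  | zero =>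
    refine (variance_sum_le_card_mul_of_const (Finset.empty_subset J) hf fun i _ _ =>
      ⟨f i default, fun y => by rw [Subsingleton.elim y default]⟩).trans ?_
    rw [Finset.card_empty, Nat.cast_zero, zero_mul]
    exact mul_nonneg s.cast_nonneg (Finset.sum_nonneg fun i _ => variance_nonneg _ _)
  | succ m ih =>
    have hcons := measurePreserving_cons μ
    have hg := fun i (hi : i ∈ J) => (hf i hi).comp_measurePreserving hcons
    rw [← hcons.variance_fun_comp (memLp_finsetSum J hf).aemeasurable, Finset.sum_congr rfl
      fun i hi => (hcons.variance_fun_comp (hf i hi).aemeasurable).symm]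
    refine variance_sum_prod_le hg ?_ ?_
    · filter_upwards [(ae_ball_iff J.countable_toSet).2 fun i hi => ae_memLp_two_section (hg i hi)]
        with t ht
      refine ih (fun j => μ j.succ) (fun i => Finset.univ.filter fun k => k.succ ∈ S i)
        (fun j => by simpa using hs j.succ) ht fun i hi w w' hw => hfS i hi fun k hk => ?_
      cases k using Fin.cases with
      | zero => rfl
      | succ k => simpa using hw k (by simpa using hk)
    · refine (variance_sum_le_card_mul_of_const (Finset.filter_subset (fun i => 0 ∈ S i) J)
        (fun i hi => memLp_two_integral_section (hg i hi)) fun i hi hi0 => ?_).trans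
        (mul_le_mul_of_nonneg_right (Nat.cast_le.2 (hs 0))
          (Finset.sum_nonneg fun i _ => variance_nonneg _ _))
      obtain ⟨t₀⟩ := (μ 0).nonempty_of_neZero
      refine ⟨∫ w, f i (Fin.cons t₀ w) ∂Measure.pi fun j => μ j.succ, fun t =>
        integral_congr_ae (ae_of_all _ fun w => hfS i hi fun k hk => ?_)⟩
      cases k using Fin.cases with
      | zero => exact absurd (Finset.mem_filter.2 ⟨hi, hk⟩) hi0
      | succ k => rfl

end SparseVariance

/-! ### The square of an excess -/

section Excess

variable {α : Type*} [MeasurableSpace α]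

lemma lintegral_pi_succ {m : ℕ} (μ : Fin (m + 1) → Measure α) [∀ j, IsProbabilityMeasure (μ j)]
    {f : (Fin (m + 1) → α) → ℝ≥0∞} (hf : Measurable f) :
    ∫⁻ y, f y ∂Measure.pi μ
      = ∫⁻ t, ∫⁻ w, f (Fin.cons t w) ∂(Measure.pi fun j => μ j.succ) ∂μ 0 := by
  have hcons := measurePreserving_cons μ
  rw [← hcons.lintegral_comp hf]
  exact lintegral_prod _ (hf.comp hcons.measurable).aemeasurable

lemma measure_pi_succ {m : ℕ} (μ : Fin (m + 1) → Measure α) [∀ j, IsProbabilityMeasure (μ j)]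
    {S : Set (Fin (m + 1) → α)} (hS : MeasurableSet S) :
    Measure.pi μ S
      = ∫⁻ t, (Measure.pi fun j => μ j.succ) {w | (Fin.cons t w : Fin (m + 1) → α) ∈ S} ∂μ 0 := by
  have hcons := measurePreserving_cons μ
  rw [← hcons.measure_preimage hS.nullMeasurableSet, Measure.prod_apply (hcons.measurable hS)]
  rfl

lemma lintegral_add_excess_sq_le {Q : Measure α} [IsProbabilityMeasure Q] {Z : α → ℝ≥0}
    {a τ : ℝ≥0} (ha : a ≤ τ)
    (hZ : ∀ c, ∫⁻ w, ((Z w - c - τ : ℝ≥0) : ℝ≥0∞) ^ 2 ∂Q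
      ≤ Q {w | c < Z w} * ∫⁻ w, (Z w : ℝ≥0∞) ^ 2 ∂Q) (c : ℝ≥0) :
    ∫⁻ w, ((a + Z w - c - τ : ℝ≥0) : ℝ≥0∞) ^ 2 ∂Q
      ≤ Q {w | c < a + Z w} * ∫⁻ w, (Z w : ℝ≥0∞) ^ 2 ∂Q := by
  obtain hc | hc := lt_or_ge c a
  · have huniv : {w | c < a + Z w} = Set.univ :=
      Set.eq_univ_of_forall fun w => hc.trans_le le_self_add
    rw [huniv, measure_univ, one_mul]
    gcongr with w
    rw [tsub_tsub, tsub_le_iff_left]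
    gcongr
    exact ha.trans le_add_self
  · have hset : {w | c < a + Z w} = {w | c - a < Z w} :=
      Set.ext fun w => (tsub_lt_iff_left hc).symm
    have hsub (w : α) : a + Z w - c = Z w - (c - a) := by
      conv_lhs => rw [← add_tsub_cancel_of_le hc, add_tsub_add_eq_tsub_left]
    simp only [hset, hsub]
    exact hZ (c - a)

/-- Reveal the coordinates one by one until the partial sum exceeds `c`. It then exceeds `c` by at
most `τ`, so what is left of the excess is at most the sum of the coordinates not yet revealed,
which are independent of the event that the sum exceeds `c` so far. -/
theorem lintegral_excess_sq_le {m : ℕ} (μ : Fin m → Measure α) [∀ j, IsProbabilityMeasure (μ j)]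
    {z : Fin m → α → ℝ≥0} (hz : ∀ j, Measurable (z j)) {τ : ℝ≥0} (hτ : ∀ j t, z j t ≤ τ)
    (c : ℝ≥0) :
    ∫⁻ y, ((∑ j, z j (y j) - c - τ : ℝ≥0) : ℝ≥0∞) ^ 2 ∂Measure.pi μ
      ≤ Measure.pi μ {y | c < ∑ j, z j (y j)}
        * ∫⁻ y, ((∑ j, z j (y j) : ℝ≥0) : ℝ≥0∞) ^ 2 ∂Measure.pi μ := by
  induction m generalizing c with
  | zero => simp
  | succ m ih =>
    set Q : Measure (Fin m → α) := Measure.pi fun j => μ j.succ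
    let Z (w : Fin m → α) : ℝ≥0 := ∑ j, z j.succ (w j)
    have hmeas : Measurable fun y : Fin (m + 1) → α => ∑ j, z j (y j) := by fun_prop
    have hevent : MeasurableSet {p : α × (Fin m → α) | c < z 0 p.1 + Z p.2} :=
      measurableSet_lt measurable_const (by fun_prop)
    have hsection (t : α) : ∫⁻ w, ((z 0 t + Z w - c - τ : ℝ≥0) : ℝ≥0∞) ^ 2 ∂Q
        ≤ Q {w | c < z 0 t + Z w} * ∫⁻ w, (Z w : ℝ≥0∞) ^ 2 ∂Q :=
      lintegral_add_excess_sq_le (hτ 0 t)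
        (ih (fun j => μ j.succ) (fun j => hz j.succ) fun j => hτ j.succ) c
    rw [lintegral_pi_succ μ (by fun_prop), lintegral_pi_succ μ (by fun_prop),
      measure_pi_succ μ (measurableSet_lt measurable_const hmeas)]
    simp only [Fin.sum_univ_succ, Fin.cons_zero, Fin.cons_succ, Set.mem_ofPred_eq]
    calc ∫⁻ t, ∫⁻ w, ((z 0 t + Z w - c - τ : ℝ≥0) : ℝ≥0∞) ^ 2 ∂Q ∂μ 0
        ≤ ∫⁻ t, Q {w | c < z 0 t + Z w} * ∫⁻ w, (Z w : ℝ≥0∞) ^ 2 ∂Q ∂μ 0 :=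
          lintegral_mono hsection
      _ = (∫⁻ t, Q {w | c < z 0 t + Z w} ∂μ 0) * ∫⁻ w, (Z w : ℝ≥0∞) ^ 2 ∂Q :=
          lintegral_mul_const _ (measurable_measure_prodMk_left hevent)
      _ ≤ (∫⁻ t, Q {w | c < z 0 t + Z w} ∂μ 0)
            * ∫⁻ t, ∫⁻ w, ((z 0 t + Z w : ℝ≥0) : ℝ≥0∞) ^ 2 ∂Q ∂μ 0 := by
          gcongr
          calc ∫⁻ w, (Z w : ℝ≥0∞) ^ 2 ∂Q = ∫⁻ _t, ∫⁻ w, (Z w : ℝ≥0∞) ^ 2 ∂Q ∂μ 0 := by simp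
            _ ≤ _ := by
              gcongr with t w
              exact le_add_self

end Excess

section Tail

variable {Ω : Type*} [MeasurableSpace Ω] {P : Measure Ω} [IsProbabilityMeasure P] {F : Ω → ℝ}

lemma two_mul_setIntegral_le (hF : MemLp F 2 P) (B : Set Ω) (c : ℝ) :
    2 * c * ∫ ω in B, F ω ∂P ≤ (2 * c * ∫ ω, F ω ∂P + c ^ 2) * P.real B + Var[F; P] := by
  set e := ∫ ω, F ω ∂P
  have hint := hF.integrable one_le_two
  have hsq : Integrable (fun ω => (F ω - e) ^ 2) P := (hF.sub (memLp_const e)).integrable_sq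
  calc 2 * c * ∫ ω in B, F ω ∂P
      = ∫ ω in B, 2 * c * F ω ∂P := (integral_const_mul _ _).symm
    _ ≤ ∫ ω in B, ((2 * c * e + c ^ 2) + (F ω - e) ^ 2) ∂P :=
        setIntegral_mono (hint.const_mul _).integrableOn
          ((integrable_const _).add hsq).integrableOn
          fun ω => by beta_reduce; nlinarith [sq_nonneg (F ω - e - c)]
    _ = (2 * c * e + c ^ 2) * P.real B + ∫ ω in B, (F ω - e) ^ 2 ∂P := by
        rw [integral_add (integrable_const _) hsq.integrableOn, setIntegral_const, smul_eq_mul,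
          mul_comm]
    _ ≤ (2 * c * e + c ^ 2) * P.real B + Var[F; P] := by
        rw [variance_eq_integral hF.aemeasurable]
        exact add_le_add_right (setIntegral_le_integral hsq (ae_of_all _ fun ω => sq_nonneg _)) _

end Tail

/-! ### Subsets of the arrivals -/

section Combinatorics

variable {ι : Type*}

/-- The `r` smallest elements of `K` (all of `K` if it has at most `r` elements). -/
def smallest [LinearOrder ι] (r : ℕ) (K : Finset ι) : Finset ι :=
  K.filter fun i => (K.filter (· < i)).card < r

lemma card_smallest [LinearOrder ι] (r : ℕ) (K : Finset ι) :
    (smallest r K).card = min K.card r := by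
  induction K using Finset.induction_on_max with
  | empty => simp [smallest]
  | insert a K ha ih =>
    have haK : a ∉ K := fun h => (ha a h).false
    have hmax : (insert a K).filter (· < a) = K := by
      rw [Finset.filter_insert, if_neg (lt_irrefl a), Finset.filter_true_of_mem ha]
    have hlt : ∀ i ∈ K, (insert a K).filter (· < i) = K.filter (· < i) := fun i hi => by
      rw [Finset.filter_insert, if_neg (ha i hi).not_gt]
    have hrest : K.filter (fun i => ((insert a K).filter (· < i)).card < r) = smallest r K :=
      Finset.filter_congr fun i hi => by rw [hlt i hi]
    rw [smallest, Finset.filter_insert, hmax, hrest, Finset.card_insert_of_notMem haK]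
    have hnot : a ∉ smallest r K := fun h => haK (Finset.mem_filter.1 h).1
    split_ifs with hr
    · rw [Finset.card_insert_of_notMem hnot, ih, min_eq_left hr.le, min_eq_left hr]
    · rw [ih, min_eq_right (not_lt.1 hr), min_eq_right (by omega)]

/-- One of the four subsets obtained from a given one by complementing it and toggling `i`, or not,
is counted on the right. -/
lemma two_pow_card_le_four_mul_card_filter [Fintype ι] [DecidableEq ι] {i : ι} {B : Finset ι}
    (hi : i ∉ B) :
    2 ^ Fintype.card ι ≤ 4 * (Finset.univ.filter fun I : Finset ι =>
      i ∈ I ∧ 2 * (I ∩ B).card ≤ B.card).card := by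
  set T : Finset (Finset ι) := Finset.univ.filter fun I => i ∈ I ∧ 2 * (I ∩ B).card ≤ B.card
  let toggle (I : Finset ι) : Finset ι := symmDiff I {i}
  have toggle_toggle (I : Finset ι) : toggle (toggle I) = I := symmDiff_symmDiff_cancel_right _ _
  have hcover : (Finset.univ : Finset (Finset ι))
      ⊆ (T ∪ T.image toggle) ∪ (T ∪ T.image toggle).image compl := by
    intro I _
    have half (I : Finset ι) (hI : 2 * (I ∩ B).card ≤ B.card) : I ∈ T ∪ T.image toggle := by
      by_cases hiI : i ∈ I
      · exact Finset.mem_union_left _ (by simp [T, hiI, hI])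
      · refine Finset.mem_union_right _ (Finset.mem_image.2 ⟨toggle I, ?_, toggle_toggle I⟩)
        have hinter : toggle I ∩ B = I ∩ B := by
          ext k
          have : k ∈ B → k ≠ i := fun hk hki => hi (hki ▸ hk)
          simp only [toggle, Finset.mem_inter, Finset.mem_symmDiff, Finset.mem_singleton]
          tauto
        simp [T, hinter, hI, toggle, Finset.mem_symmDiff, hiI]
    have hcard : (I ∩ B).card + (Iᶜ ∩ B).card = B.card := by
      rw [Finset.inter_comm, Finset.inter_comm Iᶜ, ← Finset.sdiff_eq_inter_compl,
        Finset.card_inter_add_card_sdiff]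
    by_cases hI : 2 * (I ∩ B).card ≤ B.card
    · exact Finset.mem_union_left _ (half I hI)
    · exact Finset.mem_union_right _
        (Finset.mem_image.2 ⟨Iᶜ, half Iᶜ (by omega), compl_compl I⟩)
  calc 2 ^ Fintype.card ι = (Finset.univ : Finset (Finset ι)).card := by simp
    _ ≤ ((T ∪ T.image toggle) ∪ (T ∪ T.image toggle).image compl).card := Finset.card_le_card hcover
    _ ≤ (T ∪ T.image toggle).card + (T ∪ T.image toggle).card :=
        (Finset.card_union_le _ _).trans (Nat.add_le_add_left Finset.card_image_le _)
    _ ≤ 4 * T.card := by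
        have := (Finset.card_union_le T (T.image toggle)).trans
          (Nat.add_le_add_left Finset.card_image_le _)
        omega

lemma exists_sum_le_le_sum_add {U : Finset ι} (hU : U.Nonempty) (w : ι → ℝ) {a T : ℝ}
    (ha : a ≤ T) (hT : T ≤ a + ∑ i ∈ U, w i) :
    ∃ (D : Finset ι) (i₀ : ι), a + ∑ i ∈ D, w i ≤ T ∧ T ≤ a + ∑ i ∈ D, w i + w i₀ := by
  induction hU using Finset.Nonempty.cons_induction with
  | singleton i₀ => exact ⟨∅, i₀, by simpa using ha, by simpa using hT⟩
  | cons i₀ U hi₀ _ ih =>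
    obtain h | h := le_total T (a + ∑ i ∈ U, w i)
    · exact ih h
    · exact ⟨U, i₀, h, by rw [Finset.sum_cons] at hT; linarith⟩

end Combinatorics

/-! ### Quantiles -/

section Quantile

variable {ν : Measure ℝ≥0} {T : ℝ≥0∞}

lemma measure_Ioi_le_of_forall_gt {τ : ℝ≥0} (h : ∀ t, τ < t → ν (Set.Ioi t) ≤ T) :
    ν (Set.Ioi τ) ≤ T := by
  obtain ⟨v, hv, hvgt, hvlim⟩ := exists_seq_strictAnti_tendsto τ
  have hunion : Set.Ioi τ = ⋃ k, Set.Ioi (v k) := by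
    ext t
    simp only [Set.mem_iUnion, Set.mem_Ioi]
    exact ⟨fun ht => (hvlim.eventually (gt_mem_nhds ht)).exists,
      fun ⟨k, hk⟩ => (hvgt k).trans hk⟩
  rw [hunion, Monotone.measure_iUnion fun a b hab => Set.Ioi_subset_Ioi (hv.antitone hab)]
  exact iSup_le fun k => h (v k) (hvgt k)

lemma le_measure_Ici_of_forall_lt [IsFiniteMeasure ν] {τ : ℝ≥0} (hτ : 0 < τ)
    (h : ∀ t, t < τ → T ≤ ν (Set.Ioi t)) : T ≤ ν (Set.Ici τ) := by
  obtain ⟨v, hv, hvlt, hvlim⟩ := exists_seq_strictMono_tendsto' hτ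
  have hinter : Set.Ici τ = ⋂ k, Set.Ioi (v k) := by
    ext t
    simp only [Set.mem_iInter, Set.mem_Ioi, Set.mem_Ici]
    exact ⟨fun ht k => (hvlt k).2.trans_le ht, fun h => le_of_tendsto' hvlim fun k => (h k).le⟩
  rw [hinter, Antitone.measure_iInter (fun a b hab => Set.Ioi_subset_Ioi (hv.monotone hab))
    (fun k => measurableSet_Ioi.nullMeasurableSet) ⟨0, measure_ne_top _ _⟩]
  exact le_iInf fun k => h (v k) (hvlt k).2

lemma exists_measure_Ioi_le [IsFiniteMeasure ν] (hT : 0 < T) : ∃ t : ℝ≥0, ν (Set.Ioi t) ≤ T := by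
  have hempty : ⋂ k : ℕ, Set.Ioi (k : ℝ≥0) = ∅ := by
    refine Set.eq_empty_of_forall_notMem fun t ht => ?_
    obtain ⟨k, hk⟩ := exists_nat_gt t
    exact (Set.mem_iInter.1 ht k).not_gt hk
  have hlim := tendsto_measure_iInter_atTop (μ := ν) (s := fun k : ℕ => Set.Ioi (k : ℝ≥0))
    (fun k => measurableSet_Ioi.nullMeasurableSet)
    (fun a b hab => Set.Ioi_subset_Ioi (Nat.cast_le.2 hab)) ⟨0, measure_ne_top _ _⟩
  rw [hempty, measure_empty] at hlim
  obtain ⟨k, hk⟩ := (hlim.eventually (gt_mem_nhds hT)).exists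
  exact ⟨k, hk.le⟩

lemma exists_quantile [IsFiniteMeasure ν] (hT : 0 < T) :
    ∃ τ : ℝ≥0, ν (Set.Ioi τ) ≤ T ∧ (τ = 0 ∨ T ≤ ν (Set.Ici τ)) := by
  let S : Set ℝ≥0 := {t | ν (Set.Ioi t) ≤ T}
  refine ⟨sInf S, measure_Ioi_le_of_forall_gt fun t ht => ?_, ?_⟩
  · obtain ⟨t', ht', htt'⟩ := exists_lt_of_csInf_lt (exists_measure_Ioi_le hT) ht
    exact (measure_mono (Set.Ioi_subset_Ioi htt'.le)).trans ht'
  · refine (eq_zero_or_pos (sInf S)).imp_right fun hpos =>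
      le_measure_Ici_of_forall_lt hpos fun t ht => ?_
    exact (not_le.1 fun h => (csInf_le (OrderBot.bddBelow S) h).not_gt ht).le

end Quantile

/-! ### Thresholds -/

/-- A threshold rule for `n` arrivals: arrival `i` is acceptable if it exceeds `value`, or if it is
equal to `value` and `i ∈ ties`. -/
structure Threshold (n : ℕ) where
  value : ℝ≥0
  ties : Finset (Fin n)

namespace Threshold

variable {n : ℕ} (θ : Threshold n) {i : Fin n} {x : ℝ≥0}

/-- The acceptable values of arrival `i`. -/
def accepts (i : Fin n) : Set ℝ≥0 := {x | θ.value < x ∨ x = θ.value ∧ i ∈ θ.ties}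

lemma value_le_of_mem_accepts (h : x ∈ θ.accepts i) : θ.value ≤ x :=
  h.elim le_of_lt fun h => h.1.ge

lemma mem_accepts_of_value_lt (h : θ.value < x) : x ∈ θ.accepts i := Or.inl h

lemma measurableSet_accepts (i : Fin n) : MeasurableSet (θ.accepts i) :=
  measurableSet_Ioi.union
    ((measurableSet_singleton θ.value).inter (MeasurableSet.const (i ∈ θ.ties)))

lemma measureReal_mem_accepts {Ω : Type*} [MeasurableSpace Ω] {P : Measure Ω} [IsFiniteMeasure P]
    {X : Ω → ℝ≥0} (hX : Measurable X) (i : Fin n) :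
    P.real {ω | X ω ∈ θ.accepts i} = P.real {ω | θ.value < X ω}
      + if i ∈ θ.ties then P.real {ω | X ω = θ.value} else 0 := by
  split_ifs with hi
  · have hunion : {ω | X ω ∈ θ.accepts i} = {ω | θ.value < X ω} ∪ {ω | X ω = θ.value} := by
      ext ω
      simp [accepts, hi]
    have hdisj : Disjoint {ω | θ.value < X ω} {ω | X ω = θ.value} :=
      Set.disjoint_left.2 fun ω hgt heq => (ne_of_gt hgt) heq
    rw [hunion, measureReal_union hdisj (hX (measurableSet_singleton θ.value))]
  · simp [accepts, hi]

end Threshold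

theorem exists_threshold {Ω : Type*} [MeasurableSpace Ω] {P : Measure Ω} [IsFiniteMeasure P]
    {n : ℕ} {X : Fin n → Ω → ℝ≥0} (hX : ∀ i, Measurable (X i)) {T : ℝ} (hT : 0 < T) :
    ∃ θ : Threshold n, ∑ i, P.real {ω | X i ω ∈ θ.accepts i} ≤ T ∧
      (θ.value = 0 ∨ ∃ i₀, T ≤ ∑ i, P.real {ω | X i ω ∈ θ.accepts i}
        + P.real {ω | X i₀ ω = θ.value}) := by
  let ν : Measure ℝ≥0 := ∑ i, P.map (X i)
  have hν {s : Set ℝ≥0} (hs : MeasurableSet s) : ν.real s = ∑ i, P.real {ω | X i ω ∈ s} := by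
    simp only [ν, Measure.real, Measure.finsetSum_apply]
    rw [ENNReal.toReal_sum fun i _ => measure_ne_top _ _]
    exact Finset.sum_congr rfl fun i _ => by rw [Measure.map_apply (hX i) hs]; rfl
  obtain ⟨τ, hle, hτ⟩ := exists_quantile (ν := ν) (ENNReal.ofReal_pos.2 hT)
  have hle' : ∑ i, P.real {ω | τ < X i ω} ≤ T :=
    (hν measurableSet_Ioi).symm.trans_le (ENNReal.toReal_le_of_le_ofReal hT.le hle)
  have haccept (D : Finset (Fin n)) : ∑ i, P.real {ω | X i ω ∈ (Threshold.mk τ D).accepts i}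
      = ∑ i, P.real {ω | τ < X i ω} + ∑ i ∈ D, P.real {ω | X i ω = τ} := by
    simp only [fun i => (Threshold.mk τ D).measureReal_mem_accepts (P := P) (hX i) i,
      Finset.sum_add_distrib, Finset.sum_ite_mem, Finset.univ_inter]
  obtain rfl | hge := hτ
  · exact ⟨⟨0, ∅⟩, by simpa [haccept] using hle', Or.inl rfl⟩
  have hge' : T ≤ ∑ i, P.real {ω | τ < X i ω} + ∑ i, P.real {ω | X i ω = τ} := by
    rw [← haccept]
    refine ((ENNReal.ofReal_le_iff_le_toReal (measure_ne_top _ _)).1 hge).trans_eq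
      ((hν measurableSet_Ici).trans ?_)
    simp [Threshold.accepts, le_iff_lt_or_eq, eq_comm]
  have hn : (Finset.univ : Finset (Fin n)).Nonempty := by
    refine Finset.nonempty_iff_ne_empty.2 fun hempty => hT.not_ge ?_
    simpa [hempty] using hge'
  obtain ⟨D, i₀, hD, hi₀⟩ := exists_sum_le_le_sum_add hn _ hle' hge'
  exact ⟨⟨τ, D⟩, (haccept D).trans_le hD, Or.inr ⟨i₀, by rw [haccept]; exact hi₀⟩⟩

/-! ### Greedy algorithms -/

namespace Threshold

section Greedy

variable {n : ℕ} (θ : Threshold n) (r : ℕ) (I : Finset (Fin n)) (x : Fin n → ℝ≥0) {i : Fin n}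

open Classical in
/-- The arrivals in `I` with an acceptable value. -/
def candidates : Finset (Fin n) := I.filter fun i => x i ∈ θ.accepts i

/-- The first `r` candidates in `I`. -/
def greedySelect : Finset (Fin n) := smallest r (θ.candidates I x)

/-- The total value of the first `r` candidates in `I`. -/
def greedyReward : ℝ≥0 := ∑ i ∈ θ.greedySelect r I x, x i

variable {θ r I x}

lemma mem_candidates : i ∈ θ.candidates I x ↔ i ∈ I ∧ x i ∈ θ.accepts i := by
  simp [candidates]

lemma greedySelect_subset : θ.greedySelect r I x ⊆ θ.candidates I x := Finset.filter_subset _ _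

lemma mem_greedySelect :
    i ∈ θ.greedySelect r I x
      ↔ i ∈ I ∧ x i ∈ θ.accepts i ∧ (θ.candidates (I.filter (· < i)) x).card < r := by
  have hbefore : (θ.candidates I x).filter (· < i) = θ.candidates (I.filter (· < i)) x := by
    ext k
    simp only [Finset.mem_filter, mem_candidates, and_right_comm]
  rw [greedySelect, smallest, Finset.mem_filter, hbefore, mem_candidates, and_assoc]

lemma mem_greedySelect_of_card_lt {K : Finset (Fin n)} (hiI : i ∈ I) (hx : x i ∈ θ.accepts i)
    (hK : (θ.candidates Kᶜ x).card + (I ∩ K.erase i).card < r) : i ∈ θ.greedySelect r I x := by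
  refine mem_greedySelect.2 ⟨hiI, hx, lt_of_le_of_lt ?_ hK⟩
  refine (Finset.card_le_card fun k hk => ?_).trans (Finset.card_union_le _ _)
  simp only [mem_candidates, Finset.mem_filter] at hk
  by_cases hkK : k ∈ K
  · exact Finset.mem_union_right _
      (Finset.mem_inter.2 ⟨hk.1.1, Finset.mem_erase.2 ⟨hk.1.2.ne, hkK⟩⟩)
  · exact Finset.mem_union_left _ (mem_candidates.2 ⟨Finset.mem_compl.2 hkK, hk.2⟩)

lemma mem_greedySelect_of_card_le (hiI : i ∈ I) (hx : x i ∈ θ.accepts i)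
    (hr : (θ.candidates I x).card ≤ r) : i ∈ θ.greedySelect r I x := by
  have hi := mem_candidates.2 ⟨hiI, hx⟩
  refine Finset.mem_filter.2 ⟨hi, (Finset.card_lt_card ?_).trans_le hr⟩
  exact Finset.filter_ssubset.2 ⟨i, hi, lt_irrefl i⟩

lemma value_mul_min_le_greedyReward :
    θ.value * (min (θ.candidates I x).card r : ℕ) ≤ θ.greedyReward r I x := by
  rw [← card_smallest, mul_comm, ← nsmul_eq_mul]
  exact Finset.card_nsmul_le_sum _ _ _ fun i hi =>
    value_le_of_mem_accepts θ (mem_candidates.1 (greedySelect_subset hi)).2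

lemma sum_le_greedyReward {f : Fin n → ℝ} (hf : ∀ i ∈ θ.greedySelect r I x, f i ≤ x i)
    (hf' : ∀ i ∉ θ.greedySelect r I x, f i ≤ 0) : ∑ i, f i ≤ θ.greedyReward r I x := by
  rw [greedyReward, NNReal.coe_sum, ← Finset.sum_add_sum_compl (θ.greedySelect r I x) f]
  have hrejected : ∑ i ∈ (θ.greedySelect r I x)ᶜ, f i ≤ 0 :=
    Finset.sum_nonpos fun i hi => hf' i (Finset.mem_compl.1 hi)
  linarith [Finset.sum_le_sum hf]

variable (θ r I)

lemma measurable_card_candidates : Measurable fun x => (θ.candidates I x).card := by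
  classical
  simp only [candidates, Finset.card_filter]
  exact Finset.measurable_sum _ fun i _ =>
    Measurable.ite (measurable_pi_apply i (θ.measurableSet_accepts i)) measurable_const
      measurable_const

lemma measurableSet_mem_greedySelect (i : Fin n) :
    MeasurableSet {x | i ∈ θ.greedySelect r I x} := by
  have hinter : {x | i ∈ θ.greedySelect r I x} = {_x | i ∈ I} ∩ (Function.eval i ⁻¹' θ.accepts i
      ∩ {x | (θ.candidates (I.filter (· < i)) x).card < r}) :=
    Set.ext fun _ => mem_greedySelect
  rw [hinter]
  exact (MeasurableSet.const _).inter ((measurable_pi_apply i (θ.measurableSet_accepts i)).inter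
    (measurableSet_lt (θ.measurable_card_candidates _) measurable_const))

lemma measurable_greedyReward : Measurable (θ.greedyReward r I) := by
  classical
  have hsum : θ.greedyReward r I
      = fun x => ∑ i, if i ∈ θ.greedySelect r I x then x i else 0 := by
    ext x
    simp [greedyReward]
  rw [hsum]
  exact Finset.measurable_sum _ fun i _ => Measurable.ite (θ.measurableSet_mem_greedySelect r I i)
    (measurable_pi_apply i) measurable_const

/-- The deterministic algorithm accepting the first `r` candidates in `I`. -/
def greedy : OnlineAlgorithm n r where
  Seed := Unit
  seedSpace := inferInstance
  seedLaw := Measure.dirac ()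
  seedLaw_prob := inferInstance
  select := fun _ x => θ.greedySelect r I x
  select_online := fun _ i x x' h => by
    have hbefore : θ.candidates (I.filter (· < i)) x = θ.candidates (I.filter (· < i)) x' := by
      ext k
      simp only [mem_candidates, Finset.mem_filter]
      exact and_congr_right fun hk => by rw [h k hk.2.le]
    rw [mem_greedySelect, mem_greedySelect, hbefore, h i le_rfl]
  select_measurable := fun i => measurable_snd (θ.measurableSet_mem_greedySelect r I i)
  select_card := fun _ x => (card_smallest r _).trans_le (min_le_right _ _)

lemma expectedReward_greedy {m : ℕ} (A : Matrix (Fin n) (Fin m) ℝ≥0) (μ : Fin m → Measure ℝ≥0) :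
    expectedReward (θ.greedy r I) A μ
      = ∫⁻ y, (θ.greedyReward r I (A.mulVec y) : ℝ≥0∞) ∂Measure.pi μ :=
  lintegral_dirac (α := Unit) _ _

end Greedy

end Threshold

/-! ### Arrivals and features -/

section Support

variable {n m : ℕ} (A : Matrix (Fin n) (Fin m) ℝ≥0)

/-- The features that influence arrival `i`. -/
def rowSupport (i : Fin n) : Finset (Fin m) := Finset.univ.filter fun j => A i j ≠ 0

/-- The arrivals that are influenced by feature `j`. -/
def colSupport (j : Fin m) : Finset (Fin n) := Finset.univ.filter fun i => A i j ≠ 0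

variable {A} in
lemma mem_colSupport {i : Fin n} {j : Fin m} : i ∈ colSupport A j ↔ A i j ≠ 0 := by
  simp [colSupport]

lemma card_colSupport_le (j : Fin m) : (colSupport A j).card ≤ colSparsity A :=
  Finset.le_sup (f := fun j => (colSupport A j).card) (Finset.mem_univ j)

lemma card_filter_mem_rowSupport_le (j : Fin m) :
    (Finset.univ.filter fun i => j ∈ rowSupport A i).card ≤ colSparsity A := by
  simpa [rowSupport, colSupport] using card_colSupport_le A j

lemma coe_mulVec (y : Fin m → ℝ≥0) (i : Fin n) :
    ((A.mulVec y i : ℝ≥0) : ℝ) = ∑ j, ((A i j * y j : ℝ≥0) : ℝ) := by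
  simp [Matrix.mulVec, dotProduct]

lemma mul_le_mulVec (y : Fin m → ℝ≥0) (i : Fin n) (j : Fin m) : A i j * y j ≤ A.mulVec y i :=
  Finset.single_le_sum (f := fun k => A i k * y k) (fun _ _ => zero_le) (Finset.mem_univ j)

lemma measurable_mulVec : Measurable fun y : Fin m → ℝ≥0 => A.mulVec y := by
  refine measurable_pi_lambda _ fun i => ?_
  simp only [Matrix.mulVec, dotProduct]
  fun_prop

lemma measurable_mulVec_apply (i : Fin n) : Measurable fun y : Fin m → ℝ≥0 => A.mulVec y i :=
  (measurable_pi_apply i).comp (measurable_mulVec A)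

variable {A} in
lemma mul_eq_mul_of_eqOn_rowSupport {y y' : Fin m → ℝ≥0} {i : Fin n}
    (h : ∀ j ∈ rowSupport A i, y j = y' j) (j : Fin m) : A i j * y j = A i j * y' j := by
  by_cases hj : A i j = 0
  · simp [hj]
  · rw [h j (by simp [rowSupport, hj])]

lemma dependsOn_mulVec_apply (i : Fin n) :
    DependsOn (fun y : Fin m → ℝ≥0 => A.mulVec y i) (rowSupport A i : Set (Fin m)) := by
  intro y y' h
  simp only [Matrix.mulVec, dotProduct]
  exact Finset.sum_congr rfl fun j _ => mul_eq_mul_of_eqOn_rowSupport h j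

end Support

/-! ### Decomposing the values of the candidates -/

namespace Threshold

section Decomposition

variable {n m : ℕ} (θ : Threshold n) (A : Matrix (Fin n) (Fin m) ℝ≥0) (H : Finset (Fin n))
  (i : Fin n) (j : Fin m) (y : Fin m → ℝ≥0)

/-- The event that arrival `i` is a candidate. -/
def hitSet : Set (Fin m → ℝ≥0) := {y | A.mulVec y i ∈ θ.accepts i}

/-- The event that the contribution of feature `j` to arrival `i` is accounted for separately: for
the likely candidates `i ∈ H`, that `i` is a candidate; for all other arrivals, that the
contribution exceeds the threshold on its own. -/
def shareSet : Set (Fin m → ℝ≥0) :=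
  if i ∈ H then θ.hitSet A i else {y | θ.value < A i j * y j}

/-- The part of the contribution of feature `j` to arrival `i` that is accounted for separately. -/
def share : (Fin m → ℝ≥0) → ℝ :=
  (θ.shareSet A H i j).indicator fun y => ((A i j * y j : ℝ≥0) : ℝ)

/-- The total of those contributions to arrival `i` that do not exceed the threshold on their
own. -/
def smallSum : ℝ≥0 := ∑ j, if θ.value < A i j * y j then 0 else A i j * y j

/-- The part of the value of a candidate `i` that is not accounted for by the shares. -/
def rest : (Fin m → ℝ≥0) → ℝ :=
  if i ∈ H then 0 else (θ.hitSet A i).indicator fun y => (θ.smallSum A i y : ℝ)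

/-- The event that at most `h` of the arrivals that are not influenced by feature `j` are
candidates. -/
def roomSet (h : ℕ) : Set (Fin m → ℝ≥0) :=
  {y | (θ.candidates (colSupport A j)ᶜ (A.mulVec y)).card ≤ h}

/-- The number of candidates. -/
def hitCount : ℕ := (θ.candidates Finset.univ (A.mulVec y)).card

lemma measurableSet_hitSet : MeasurableSet (θ.hitSet A i) :=
  measurable_mulVec_apply A i (θ.measurableSet_accepts i)

lemma dependsOn_mem_hitSet : DependsOn (· ∈ θ.hitSet A i) (rowSupport A i : Set (Fin m)) :=
  fun y y' h => by
    have hX : A.mulVec y i = A.mulVec y' i := dependsOn_mulVec_apply A i h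
    simp only [hitSet, Set.mem_ofPred_eq, hX]

lemma measurable_hitCount : Measurable (θ.hitCount A) :=
  (θ.measurable_card_candidates _).comp (measurable_mulVec A)

lemma hitCount_eq_sum :
    (θ.hitCount A y : ℝ) = ∑ i, (θ.hitSet A i).indicator (1 : (Fin m → ℝ≥0) → ℝ) y := by
  classical
  simp [hitCount, candidates, hitSet, Set.indicator_apply]

lemma measurableSet_roomSet (h : ℕ) : MeasurableSet (θ.roomSet A j h) :=
  measurableSet_le ((θ.measurable_card_candidates _).comp (measurable_mulVec A)) measurable_const

lemma compl_roomSet_subset (h : ℕ) : (θ.roomSet A j h)ᶜ ⊆ {y | h < θ.hitCount A y} := by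
  intro y hy
  have hlt : h < (θ.candidates (colSupport A j)ᶜ (A.mulVec y)).card := not_le.1 hy
  refine hlt.trans_le (Finset.card_le_card fun i hi => ?_)
  exact mem_candidates.2 ⟨Finset.mem_univ i, (mem_candidates.1 hi).2⟩

lemma dependsOn_mem_compl_roomSet (h : ℕ) :
    DependsOn (· ∈ (θ.roomSet A j h)ᶜ) (({j}ᶜ : Finset (Fin m)) : Set (Fin m)) := fun y y' hy => by
  have hcand : θ.candidates (colSupport A j)ᶜ (A.mulVec y)
      = θ.candidates (colSupport A j)ᶜ (A.mulVec y') := by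
    ext i
    simp only [mem_candidates, Finset.mem_compl, mem_colSupport, not_not]
    refine and_congr_right fun hij => ?_
    have hX : A.mulVec y i = A.mulVec y' i := dependsOn_mulVec_apply A i fun k hk => hy k (by
      rw [Finset.coe_compl, Finset.coe_singleton, Set.mem_compl_singleton_iff]
      rintro rfl
      simp [rowSupport, hij] at hk)
    rw [hX]
  simp only [roomSet, Set.mem_compl_iff, Set.mem_ofPred_eq, hcand]

variable {θ A y i} in
lemma mem_hitSet_of_value_lt (h : θ.value < A.mulVec y i) : y ∈ θ.hitSet A i :=
  mem_accepts_of_value_lt θ h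

lemma shareSet_subset_hitSet : θ.shareSet A H i j ⊆ θ.hitSet A i := by
  unfold shareSet
  split_ifs
  · exact subset_rfl
  · exact fun y hy => mem_hitSet_of_value_lt (lt_of_lt_of_le hy (mul_le_mulVec A y i j))

lemma share_nonneg : 0 ≤ θ.share A H i j y :=
  Set.indicator_nonneg (fun _ _ => NNReal.coe_nonneg _) y

lemma share_le : θ.share A H i j y ≤ ((A i j * y j : ℝ≥0) : ℝ) :=
  Set.indicator_le_self' (fun _ _ => NNReal.coe_nonneg _) y

variable {θ A i j y} in
lemma share_eq_zero_of_notMem_hitSet (h : y ∉ θ.hitSet A i) : θ.share A H i j y = 0 :=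
  Set.indicator_of_notMem (fun hy => h (θ.shareSet_subset_hitSet A H i j hy)) _

variable {A i j} in
lemma share_eq_zero_of_notMem_colSupport (h : i ∉ colSupport A j) : θ.share A H i j y = 0 := by
  have hij : A i j = 0 := by simpa [mem_colSupport] using h
  exact le_antisymm ((θ.share_le A H i j y).trans_eq (by simp [hij])) (θ.share_nonneg A H i j y)

lemma measurable_share : Measurable (θ.share A H i j) := by
  refine Measurable.indicator (by fun_prop) ?_
  unfold shareSet
  split_ifs
  · exact θ.measurableSet_hitSet A i
  · exact measurableSet_lt measurable_const (by fun_prop)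

lemma smallSum_le : θ.smallSum A i y ≤ m * θ.value := by
  refine (Finset.sum_le_card_nsmul _ _ θ.value fun j _ => ?_).trans_eq (by simp)
  split_ifs with h
  · exact zero_le
  · exact not_lt.1 h

lemma smallSum_le_mulVec : θ.smallSum A i y ≤ A.mulVec y i :=
  Finset.sum_le_sum fun j _ => by split_ifs <;> simp

lemma measurable_smallSum : Measurable (θ.smallSum A i) :=
  Finset.measurable_sum _ fun j _ =>
    Measurable.ite (measurableSet_lt measurable_const (by fun_prop)) measurable_const (by fun_prop)

lemma rest_nonneg : 0 ≤ θ.rest A H i y := by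
  unfold rest
  split_ifs
  · exact le_rfl
  · exact Set.indicator_nonneg (fun _ _ => NNReal.coe_nonneg _) y

lemma rest_le : θ.rest A H i y ≤ m * θ.value := by
  unfold rest
  split_ifs
  · exact mul_nonneg (Nat.cast_nonneg m) θ.value.coe_nonneg
  · refine (Set.indicator_le_self' (fun _ _ => NNReal.coe_nonneg _) y).trans ?_
    exact_mod_cast θ.smallSum_le A i y

variable {θ A i y} in
lemma rest_eq_zero_of_notMem_hitSet (h : y ∉ θ.hitSet A i) : θ.rest A H i y = 0 := by
  unfold rest
  split_ifs
  · rfl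
  · exact Set.indicator_of_notMem h _

lemma measurable_rest : Measurable (θ.rest A H i) := by
  unfold rest
  split_ifs
  · exact measurable_const
  · exact (θ.measurable_smallSum A i).coe_nnreal_real.indicator (θ.measurableSet_hitSet A i)

lemma memLp_rest (P : Measure (Fin m → ℝ≥0)) [IsProbabilityMeasure P] (p : ℝ≥0∞) :
    MemLp (θ.rest A H i) p P :=
  MemLp.of_bound (θ.measurable_rest A H i).aestronglyMeasurable (m * θ.value)
    (Eventually.of_forall fun y => by
      rw [Real.norm_of_nonneg (θ.rest_nonneg A H i y)]
      exact θ.rest_le A H i y)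

lemma dependsOn_rest : DependsOn (θ.rest A H i) (rowSupport A i : Set (Fin m)) := by
  intro y y' h
  have hhit : (y ∈ θ.hitSet A i) = (y' ∈ θ.hitSet A i) := θ.dependsOn_mem_hitSet A i h
  unfold rest
  split_ifs
  · rfl
  · have hsum : θ.smallSum A i y = θ.smallSum A i y' := by
      simp only [smallSum, mul_eq_mul_of_eqOn_rowSupport h]
    classical
    simp only [Set.indicator_apply, hhit, hsum]

theorem sum_share_add_rest :
    ∑ j, θ.share A H i j y + θ.rest A H i y
      = (θ.hitSet A i).indicator (fun y => ((A.mulVec y i : ℝ≥0) : ℝ)) y := by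
  by_cases hy : y ∈ θ.hitSet A i
  swap
  · rw [Set.indicator_of_notMem hy, rest_eq_zero_of_notMem_hitSet H hy, add_zero]
    exact Finset.sum_eq_zero fun j _ => share_eq_zero_of_notMem_hitSet H hy
  rw [Set.indicator_of_mem hy, coe_mulVec]
  by_cases hi : i ∈ H
  · simp [share, shareSet, rest, hi, hy]
  · simp only [share, shareSet, rest, hi, if_false, Set.indicator_of_mem hy, smallSum,
      NNReal.coe_sum, ← Finset.sum_add_distrib]
    refine Finset.sum_congr rfl fun j _ => ?_
    by_cases hj : θ.value < A i j * y j <;> simp [hj]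

end Decomposition

/-! ### Pointwise bounds for the greedy reward -/

section PointwiseReward

variable {n m r s : ℕ} (θ : Threshold n) {A : Matrix (Fin n) (Fin m) ℝ≥0} (H : Finset (Fin n))
  (y : Fin m → ℝ≥0)

lemma sum_sum_add_le_greedyReward {I : Finset (Fin n)} {f : Fin n → Fin m → ℝ} {g : Fin n → ℝ}
    (hf : ∀ i j, f i j ≤ θ.share A H i j y) (hg : ∀ i, g i ≤ θ.rest A H i y)
    (hf' : ∀ i j, i ∈ colSupport A j → y ∈ θ.hitSet A i →
      i ∉ θ.greedySelect r I (A.mulVec y) → f i j ≤ 0)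
    (hg' : ∀ i, y ∈ θ.hitSet A i → i ∉ θ.greedySelect r I (A.mulVec y) → g i ≤ 0) :
    ∑ i, (∑ j, f i j + g i) ≤ θ.greedyReward r I (A.mulVec y) := by
  refine sum_le_greedyReward (fun i _ => ?_) fun i hi => ?_
  · refine (add_le_add (Finset.sum_le_sum fun j _ => hf i j) (hg i)).trans ?_
    rw [sum_share_add_rest]
    exact Set.indicator_le_self' (fun _ _ => NNReal.coe_nonneg _) y
  · by_cases hy : y ∈ θ.hitSet A i
    · refine add_nonpos (Finset.sum_nonpos fun j _ => ?_) (hg' i hy hi)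
      by_cases hij : i ∈ colSupport A j
      · exact hf' i j hij hy hi
      · exact (hf i j).trans_eq (θ.share_eq_zero_of_notMem_colSupport H y hij)
    · exact add_nonpos (Finset.sum_nonpos fun j _ =>
        (hf i j).trans_eq (share_eq_zero_of_notMem_hitSet H hy))
        ((hg i).trans_eq (rest_eq_zero_of_notMem_hitSet H hy))

theorem sum_indicator_share_add_rest_le_greedyReward (hA : colSparsity A ≤ s) (hsr : s ≤ r) :
    ∑ i, (∑ j, (θ.roomSet A j (r - s)).indicator (θ.share A H i j) y
        + {y | θ.hitCount A y ≤ r}.indicator (θ.rest A H i) y)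
      ≤ θ.greedyReward r Finset.univ (A.mulVec y) := by
  refine θ.sum_sum_add_le_greedyReward H y
    (fun i j => Set.indicator_le_self' (fun y _ => θ.share_nonneg A H i j y) y)
    (fun i => Set.indicator_le_self' (fun y _ => θ.rest_nonneg A H i y) y)
    (fun i j hij hy hi => (Set.indicator_of_notMem (fun hroom => hi ?_) _).le)
    (fun i hy hi => (Set.indicator_of_notMem (fun hcount => hi ?_) _).le)
  · refine mem_greedySelect_of_card_lt (Finset.mem_univ i) hy (K := colSupport A j) ?_
    have hroom : (θ.candidates (colSupport A j)ᶜ (A.mulVec y)).card ≤ r - s := hroom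
    have hcol := card_colSupport_le A j
    have hpos := Finset.card_pos.2 ⟨i, hij⟩
    rw [Finset.univ_inter, Finset.card_erase_of_mem hij]
    omega
  · exact mem_greedySelect_of_card_le (Finset.mem_univ i) hy hcount

lemma sum_ite_indicator_share_le_greedyReward {h : ℕ} (hA : colSparsity A ≤ r) (hh : 2 * h < r)
    (I : Finset (Fin n)) :
    ∑ i, ∑ j, (if i ∈ I ∧ 2 * (I ∩ (colSupport A j).erase i).card ≤ ((colSupport A j).erase i).card
        then (θ.roomSet A j h).indicator (θ.share A H i j) y else 0)
      ≤ θ.greedyReward r I (A.mulVec y) := by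
  refine le_of_eq_of_le (Finset.sum_congr rfl fun i _ => (add_zero _).symm)
    (θ.sum_sum_add_le_greedyReward H y (fun i j => ?_) (θ.rest_nonneg A H · y)
      (fun i j hij hy hi => ?_) fun i _ _ => le_rfl)
  · split_ifs
    · exact Set.indicator_le_self' (fun y _ => θ.share_nonneg A H i j y) y
    · exact θ.share_nonneg A H i j y
  · refine (ite_eq_right_iff.2 fun hgood => Set.indicator_of_notMem (fun hroom => hi ?_) _).le
    refine mem_greedySelect_of_card_lt hgood.1 hy (K := colSupport A j) ?_
    have hroom : (θ.candidates (colSupport A j)ᶜ (A.mulVec y)).card ≤ h := hroom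
    have hcol := card_colSupport_le A j
    have hpos := Finset.card_pos.2 ⟨i, hij⟩
    have hhalf := hgood.2
    rw [Finset.card_erase_of_mem hij] at hhalf
    omega

theorem two_pow_mul_sum_indicator_share_le {h : ℕ} (hA : colSparsity A ≤ r) (hh : 2 * h < r) :
    2 ^ n * ∑ i, ∑ j, (θ.roomSet A j h).indicator (θ.share A H i j) y
      ≤ 4 * ∑ I : Finset (Fin n), (θ.greedyReward r I (A.mulVec y) : ℝ) := by
  let good (I : Finset (Fin n)) (i : Fin n) (j : Fin m) : Prop :=
    i ∈ I ∧ 2 * (I ∩ (colSupport A j).erase i).card ≤ ((colSupport A j).erase i).card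
  let f (i : Fin n) (j : Fin m) : ℝ := (θ.roomSet A j h).indicator (θ.share A H i j) y
  have hf (i j) : 0 ≤ f i j := Set.indicator_nonneg (fun y _ => θ.share_nonneg A H i j y) y
  have hpair (i j) : 2 ^ n * f i j ≤ 4 * ∑ I, if good I i j then f i j else 0 := by
    have hcard : (2 : ℝ) ^ n ≤ 4 * (Finset.univ.filter fun I => good I i j).card := by
      exact_mod_cast (congrArg (2 ^ ·) (Fintype.card_fin n)).symm.trans_le
        (two_pow_card_le_four_mul_card_filter (Finset.notMem_erase i (colSupport A j)))
    rw [Finset.sum_ite, Finset.sum_const_zero, add_zero, Finset.sum_const, nsmul_eq_mul,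
      ← mul_assoc]
    exact mul_le_mul_of_nonneg_right hcard (hf i j)
  calc 2 ^ n * ∑ i, ∑ j, f i j = ∑ i, ∑ j, 2 ^ n * f i j := by simp only [Finset.mul_sum]
    _ ≤ ∑ i, ∑ j, 4 * ∑ I, (if good I i j then f i j else 0) :=
        Finset.sum_le_sum fun i _ => Finset.sum_le_sum fun j _ => hpair i j
    _ = 4 * ∑ i, ∑ I, ∑ j, (if good I i j then f i j else 0) := by
        simp only [← Finset.mul_sum]
        exact congrArg _ (Finset.sum_congr rfl fun i _ => Finset.sum_comm)
    _ = 4 * ∑ I, ∑ i, ∑ j, (if good I i j then f i j else 0) := by rw [Finset.sum_comm]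
    _ ≤ 4 * ∑ I, (θ.greedyReward r I (A.mulVec y) : ℝ) := by
        gcongr with I
        exact θ.sum_ite_indicator_share_le_greedyReward H y hA hh I

end PointwiseReward

end Threshold

/-! ### Second moments -/

section SumOfSmall

variable {α : Type*} [MeasurableSpace α] {m : ℕ} (μ : Fin m → Measure α)
  [∀ j, IsProbabilityMeasure (μ j)] {z : Fin m → α → ℝ≥0} {τ : ℝ≥0}

lemma sq_le_add_excess_sq (x τ : ℝ≥0) :
    (x : ℝ≥0∞) ^ 2 ≤ 8 * (τ : ℝ≥0∞) ^ 2 + 2 * ((x - τ - τ : ℝ≥0) : ℝ≥0∞) ^ 2 := by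
  have hx : x ≤ 2 * τ + (x - τ - τ) := by
    rw [tsub_tsub, two_mul]
    exact le_add_tsub
  have hsq : x ^ 2 ≤ 8 * τ ^ 2 + 2 * (x - τ - τ) ^ 2 := by
    generalize x - τ - τ = e at hx
    rw [← NNReal.coe_le_coe] at hx ⊢
    push_cast at hx ⊢
    nlinarith [sq_nonneg (2 * (τ : ℝ) - e), x.coe_nonneg]
  exact_mod_cast hsq

lemma setLIntegral_sum_sq_le_add (hz : ∀ j, Measurable (z j)) (hτ : ∀ j t, z j t ≤ τ)
    {S : Set (Fin m → α)} (hS : {y | τ < ∑ j, z j (y j)} ⊆ S) (K : Set (Fin m → α)) :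
    ∫⁻ y in K, ((∑ j, z j (y j) : ℝ≥0) : ℝ≥0∞) ^ 2 ∂Measure.pi μ
      ≤ 8 * (τ : ℝ≥0∞) ^ 2 * Measure.pi μ K + 2 * (Measure.pi μ S
        * ∫⁻ y, ((∑ j, z j (y j) : ℝ≥0) : ℝ≥0∞) ^ 2 ∂Measure.pi μ) := by
  calc ∫⁻ y in K, ((∑ j, z j (y j) : ℝ≥0) : ℝ≥0∞) ^ 2 ∂Measure.pi μ
      ≤ ∫⁻ y in K, (8 * (τ : ℝ≥0∞) ^ 2
          + 2 * ((∑ j, z j (y j) - τ - τ : ℝ≥0) : ℝ≥0∞) ^ 2) ∂Measure.pi μ :=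
        lintegral_mono fun y => sq_le_add_excess_sq _ τ
    _ = 8 * (τ : ℝ≥0∞) ^ 2 * Measure.pi μ K
          + 2 * ∫⁻ y in K, ((∑ j, z j (y j) - τ - τ : ℝ≥0) : ℝ≥0∞) ^ 2 ∂Measure.pi μ := by
        rw [lintegral_add_left measurable_const, setLIntegral_const,
          lintegral_const_mul _ (by fun_prop)]
    _ ≤ 8 * (τ : ℝ≥0∞) ^ 2 * Measure.pi μ K + 2 * (Measure.pi μ S
          * ∫⁻ y, ((∑ j, z j (y j) : ℝ≥0) : ℝ≥0∞) ^ 2 ∂Measure.pi μ) := by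
        gcongr
        exact (setLIntegral_le_lintegral _ _).trans
          ((lintegral_excess_sq_le μ hz hτ τ).trans (by gcongr))

theorem setLIntegral_sum_sq_le (hz : ∀ j, Measurable (z j)) (hτ : ∀ j t, z j t ≤ τ)
    {S : Set (Fin m → α)} (hS : {y | τ < ∑ j, z j (y j)} ⊆ S) (hS4 : Measure.pi μ S ≤ 4⁻¹) :
    ∫⁻ y in S, ((∑ j, z j (y j) : ℝ≥0) : ℝ≥0∞) ^ 2 ∂Measure.pi μ
      ≤ 40 * (τ : ℝ≥0∞) ^ 2 * Measure.pi μ S := by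
  set M := ∫⁻ y, ((∑ j, z j (y j) : ℝ≥0) : ℝ≥0∞) ^ 2 ∂Measure.pi μ
  have hMtop : M ≠ ⊤ := by
    refine ((lintegral_mono (g := fun _ => ((m * τ : ℝ≥0) : ℝ≥0∞) ^ 2) fun y => ?_).trans_lt
      (by simp [ENNReal.mul_lt_top_iff])).ne
    beta_reduce
    gcongr
    exact (Finset.sum_le_card_nsmul _ _ τ fun j _ => hτ j (y j)).trans_eq (by simp)
  have hhalf : (2 : ℝ≥0∞) * 4⁻¹ = 2⁻¹ := by
    rw [← div_eq_mul_inv, ← ENNReal.toReal_eq_toReal_iff' (by finiteness) (by finiteness)]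
    norm_num
  have hM : M ≤ 16 * (τ : ℝ≥0∞) ^ 2 := by
    have hrec : M / 2 + M / 2 ≤ 8 * (τ : ℝ≥0∞) ^ 2 + M / 2 := by
      calc M / 2 + M / 2 = ∫⁻ y in Set.univ, ((∑ j, z j (y j) : ℝ≥0) : ℝ≥0∞) ^ 2 ∂Measure.pi μ := by
            rw [ENNReal.add_halves, setLIntegral_univ]
        _ ≤ 8 * (τ : ℝ≥0∞) ^ 2 * 1 + 2 * (4⁻¹ * M) := by
            rw [← measure_univ (μ := Measure.pi μ)]
            exact (setLIntegral_sum_sq_le_add μ hz hτ hS _).trans (by gcongr)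
        _ = _ := by rw [mul_one, ← mul_assoc, hhalf, mul_comm 2⁻¹, div_eq_mul_inv]
    have hle := ENNReal.le_of_add_le_add_right (by finiteness) hrec
    calc M = M / 2 + M / 2 := (ENNReal.add_halves M).symm
      _ ≤ 8 * (τ : ℝ≥0∞) ^ 2 + 8 * (τ : ℝ≥0∞) ^ 2 := add_le_add hle hle
      _ = _ := by ring
  calc ∫⁻ y in S, ((∑ j, z j (y j) : ℝ≥0) : ℝ≥0∞) ^ 2 ∂Measure.pi μ
      ≤ 8 * (τ : ℝ≥0∞) ^ 2 * Measure.pi μ S + 2 * (Measure.pi μ S * M) :=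
        setLIntegral_sum_sq_le_add μ hz hτ hS S
    _ ≤ 8 * (τ : ℝ≥0∞) ^ 2 * Measure.pi μ S
          + 2 * (Measure.pi μ S * (16 * (τ : ℝ≥0∞) ^ 2)) := by gcongr
    _ = _ := by ring

end SumOfSmall

namespace Threshold

section Moments

variable {n m r s : ℕ} (θ : Threshold n) (A : Matrix (Fin n) (Fin m) ℝ≥0) (H : Finset (Fin n))
  (i : Fin n) (μ : Fin m → Measure ℝ≥0)

/-- The probability that arrival `i` is a candidate. -/
def hitProb : ℝ := (Measure.pi μ).real (θ.hitSet A i)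

lemma hitProb_nonneg : 0 ≤ θ.hitProb A i μ := measureReal_nonneg

/-- The likely candidates: the arrivals that are candidates with probability at least `1 / 4`. -/
def likely : Finset (Fin n) := Finset.univ.filter fun i => 1 / 4 ≤ θ.hitProb A i μ

variable {θ A i μ} in
lemma mem_likely : i ∈ θ.likely A μ ↔ 1 / 4 ≤ θ.hitProb A i μ := by simp [likely]

variable [∀ j, IsProbabilityMeasure (μ j)]

variable {H i μ} in
lemma integral_rest_sq_le (hi : i ∉ H → θ.hitProb A i μ ≤ 1 / 4) :
    ∫ y, θ.rest A H i y ^ 2 ∂Measure.pi μ ≤ 40 * (θ.value : ℝ) ^ 2 * θ.hitProb A i μ := by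
  by_cases hiH : i ∈ H
  · simp [rest, hiH, mul_nonneg, hitProb_nonneg]
  have hp : Measure.pi μ (θ.hitSet A i) ≤ 4⁻¹ := by
    rw [← ENNReal.toReal_le_toReal (by finiteness) (by finiteness)]
    exact (hi hiH).trans_eq (by norm_num)
  have hmoment : ∫⁻ y in θ.hitSet A i, (θ.smallSum A i y : ℝ≥0∞) ^ 2 ∂Measure.pi μ
      ≤ 40 * (θ.value : ℝ≥0∞) ^ 2 * Measure.pi μ (θ.hitSet A i) :=
    setLIntegral_sum_sq_le μ
      (z := fun j t => if θ.value < A i j * t then 0 else A i j * t)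
      (fun j => Measurable.ite (measurableSet_lt measurable_const (by fun_prop))
        measurable_const (by fun_prop))
      (fun j t => by
        split_ifs with h
        exacts [zero_le, not_lt.1 h])
      (fun y hy => mem_hitSet_of_value_lt (hy.trans_le (θ.smallSum_le_mulVec A i y))) hp
  have hsq (y) : ENNReal.ofReal (θ.rest A H i y ^ 2)
      = (θ.hitSet A i).indicator (fun y => (θ.smallSum A i y : ℝ≥0∞) ^ 2) y := by
    by_cases hy : y ∈ θ.hitSet A i <;> simp [rest, hiH, hy, ENNReal.ofReal_pow]
  rw [← ENNReal.ofReal_le_ofReal_iff (by positivity [θ.hitProb_nonneg A i μ]),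
    ofReal_integral_eq_lintegral_ofReal (θ.memLp_rest A H i _ 2).integrable_sq
      (ae_of_all _ fun y => sq_nonneg _)]
  simp only [hsq]
  rw [lintegral_indicator (θ.measurableSet_hitSet A i)]
  refine hmoment.trans_eq ?_
  rw [ENNReal.ofReal_mul (by positivity), hitProb, ofReal_measureReal,
    ENNReal.ofReal_mul (by positivity), ENNReal.ofReal_pow (by positivity)]
  simp

variable {H i μ} in
lemma integral_rest_le (hi : i ∉ H → θ.hitProb A i μ ≤ 1 / 4) :
    ∫ y, θ.rest A H i y ∂Measure.pi μ ≤ 21 * (θ.value * θ.hitProb A i μ) := by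
  obtain hτ | hτ := eq_zero_or_pos θ.value
  · have hrest (y) : θ.rest A H i y ≤ 0 := by simpa [hτ] using θ.rest_le A H i y
    simpa [hτ] using integral_nonpos hrest
  have hrest : Integrable (θ.rest A H i) (Measure.pi μ) :=
    (θ.memLp_rest A H i _ 1).integrable le_rfl
  have hhit := θ.measurableSet_hitSet A i
  have hpoint (y) : 2 * θ.value * θ.rest A H i y ≤ θ.rest A H i y ^ 2
      + (θ.hitSet A i).indicator (fun _ => (θ.value : ℝ) ^ 2) y := by
    by_cases hy : y ∈ θ.hitSet A i
    · rw [Set.indicator_of_mem hy]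
      linarith [sq_nonneg (θ.rest A H i y - θ.value)]
    · simp [hy, rest_eq_zero_of_notMem_hitSet H hy]
  have hsq := (θ.memLp_rest A H i (Measure.pi μ) 2).integrable_sq
  have hind := (integrable_const (μ := Measure.pi μ) ((θ.value : ℝ) ^ 2)).indicator hhit
  have hmono := integral_mono (hrest.const_mul (2 * θ.value)) (hsq.add hind) hpoint
  simp only [Pi.add_apply] at hmono
  rw [integral_const_mul, integral_add hsq hind, integral_indicator_const _ hhit, smul_eq_mul]
    at hmono
  have hmoment := θ.integral_rest_sq_le A hi
  have hvalue : (0 : ℝ) < θ.value := hτ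
  have hp : 0 ≤ θ.value * (θ.value * θ.hitProb A i μ) := by positivity [θ.hitProb_nonneg A i μ]
  change _ ≤ _ + θ.hitProb A i μ * _ at hmono
  refine le_of_mul_le_mul_left ?_ (mul_pos two_pos hvalue)
  linarith

variable {H μ} in
lemma variance_sum_rest_le (hA : colSparsity A ≤ s)
    (hH : ∀ i ∉ H, θ.hitProb A i μ ≤ 1 / 4) :
    Var[fun y => ∑ i, θ.rest A H i y; Measure.pi μ]
      ≤ s * (40 * (θ.value : ℝ) ^ 2 * ∑ i, θ.hitProb A i μ) := by
  refine (variance_sum_le_of_dependsOn μ Finset.univ (rowSupport A)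
    (fun j => (card_filter_mem_rowSupport_le A j).trans hA) (fun i _ => θ.memLp_rest A H i _ 2)
    fun i _ => θ.dependsOn_rest A H i).trans ?_
  rw [Finset.mul_sum _ _ (40 * (θ.value : ℝ) ^ 2)]
  gcongr with i
  exact (variance_le_expectation_sq (θ.measurable_rest A H i).aestronglyMeasurable).trans
    (θ.integral_rest_sq_le A (hH i))

lemma memLp_hitCount : MemLp (fun y => (θ.hitCount A y : ℝ)) 2 (Measure.pi μ) := by
  simp only [hitCount_eq_sum]
  exact memLp_finsetSum _ fun i _ =>
    memLp_indicator_const 2 (θ.measurableSet_hitSet A i) 1 (Or.inr (by finiteness))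

lemma integral_hitCount : ∫ y, (θ.hitCount A y : ℝ) ∂Measure.pi μ = ∑ i, θ.hitProb A i μ := by
  simp only [hitCount_eq_sum]
  rw [integral_finsetSum _ fun i _ =>
    (integrable_const 1).indicator (θ.measurableSet_hitSet A i)]
  exact Finset.sum_congr rfl fun i _ => integral_indicator_one (θ.measurableSet_hitSet A i)

variable {A} in
lemma variance_hitCount_le (hA : colSparsity A ≤ s) :
    Var[fun y => (θ.hitCount A y : ℝ); Measure.pi μ] ≤ s * ∑ i, θ.hitProb A i μ := by
  have hhit (i) := θ.measurableSet_hitSet A i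
  simp only [hitCount_eq_sum]
  refine (variance_sum_le_of_dependsOn μ Finset.univ (rowSupport A)
    (fun j => (card_filter_mem_rowSupport_le A j).trans hA)
    (fun i _ => memLp_indicator_const 2 (hhit i) 1 (Or.inr (by finiteness)))
    fun i _ y y' h => ?_).trans ?_
  · have hmem : (y ∈ θ.hitSet A i) = (y' ∈ θ.hitSet A i) := θ.dependsOn_mem_hitSet A i h
    classical
    simp only [Set.indicator_apply, hmem]
  · gcongr with i
    refine (variance_le_expectation_sq
      (measurable_one.indicator (hhit i)).aestronglyMeasurable).trans_eq ?_
    rw [hitProb, ← integral_indicator_one (hhit i)]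
    congr with y
    by_cases hy : y ∈ θ.hitSet A i <;> simp [hy]

end Moments

/-! ### What is lost to the cardinality constraint -/

section Losses

variable {n m r s : ℕ} (θ : Threshold n) (A : Matrix (Fin n) (Fin m) ℝ≥0) (H : Finset (Fin n))
  (i : Fin n) (j : Fin m)

section Integrability

variable {A i} {P : Measure (Fin m → ℝ≥0)}
  (hX : Integrable (fun y => ((A.mulVec y i : ℝ≥0) : ℝ)) P)

include hX

lemma integrable_mul_apply : Integrable (fun y => ((A i j * y j : ℝ≥0) : ℝ)) P :=
  hX.mono' (Measurable.aestronglyMeasurable (by fun_prop)) (ae_of_all _ fun y => by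
    rw [Real.norm_of_nonneg (NNReal.coe_nonneg _)]
    exact_mod_cast mul_le_mulVec A y i j)

lemma integrable_share : Integrable (θ.share A H i j) P :=
  (integrable_mul_apply j hX).mono' (θ.measurable_share A H i j).aestronglyMeasurable
    (ae_of_all _ fun y => by
      rw [Real.norm_of_nonneg (θ.share_nonneg A H i j y)]
      exact θ.share_le A H i j y)

end Integrability

variable (μ : Fin m → Measure ℝ≥0) [∀ j, IsProbabilityMeasure (μ j)]

variable {A} in
lemma sq_mul_measureReal_lt_hitCount_le (hA : colSparsity A ≤ s) {h : ℕ} {t : ℝ} (ht : 0 < t)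
    (hE : ∑ i, θ.hitProb A i μ + t ≤ h) :
    t ^ 2 * (Measure.pi μ).real {y | h < θ.hitCount A y} ≤ s * ∑ i, θ.hitProb A i μ := by
  have hsub : {y | h < θ.hitCount A y} ⊆
      {y | t ≤ |(θ.hitCount A y : ℝ) - ∫ y, (θ.hitCount A y : ℝ) ∂Measure.pi μ|} := by
    intro y hy
    have hlt : (h : ℝ) < θ.hitCount A y := Nat.cast_lt.2 hy
    have hdev : t ≤ (θ.hitCount A y : ℝ) - ∫ y, (θ.hitCount A y : ℝ) ∂Measure.pi μ := by
      rw [integral_hitCount]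
      linarith
    exact hdev.trans (le_abs_self _)
  have hcheb : (Measure.pi μ).real {y | h < θ.hitCount A y}
      ≤ Var[fun y => (θ.hitCount A y : ℝ); Measure.pi μ] / t ^ 2 :=
    ENNReal.toReal_le_of_le_ofReal (div_nonneg (variance_nonneg _ _) (sq_nonneg t))
      ((measure_mono hsub).trans (meas_ge_le_variance_div_sq (θ.memLp_hitCount A μ) ht))
  rw [le_div_iff₀' (by positivity)] at hcheb
  exact hcheb.trans (θ.variance_hitCount_le μ hA)

lemma mul_measureReal_lt_hitCount_le (h : ℕ) :
    (h + 1) * (Measure.pi μ).real {y | h < θ.hitCount A y} ≤ ∑ i, θ.hitProb A i μ := by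
  have hmarkov := mul_meas_ge_le_integral_of_nonneg (ae_of_all _ fun y => Nat.cast_nonneg _)
    ((θ.memLp_hitCount A μ).integrable one_le_two) (h + 1)
  rw [integral_hitCount] at hmarkov
  exact_mod_cast hmarkov

variable {A H i μ} in
lemma integral_mulVec_le_sum_integral_share (hi : i ∈ H)
    (hX : Integrable (fun y => ((A.mulVec y i : ℝ≥0) : ℝ)) (Measure.pi μ)) :
    ∫ y, ((A.mulVec y i : ℝ≥0) : ℝ) ∂Measure.pi μ
      ≤ ∑ j, ∫ y, θ.share A H i j y ∂Measure.pi μ + θ.value * (1 - θ.hitProb A i μ) := by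
  have hmiss := (θ.measurableSet_hitSet A i).compl
  have hpoint (y) : ((A.mulVec y i : ℝ≥0) : ℝ)
      ≤ ∑ j, θ.share A H i j y + (θ.hitSet A i)ᶜ.indicator (fun _ => (θ.value : ℝ)) y := by
    have hrest : θ.rest A H i y = 0 := by simp [rest, hi]
    rw [← add_zero (∑ j, θ.share A H i j y), ← hrest, sum_share_add_rest]
    by_cases hy : y ∈ θ.hitSet A i
    · simp [hy]
    · simpa [hy] using not_lt.1 fun h => hy (mem_hitSet_of_value_lt h)
  have hshare (j) := θ.integrable_share H j hX
  have hind := (integrable_const (μ := Measure.pi μ) (θ.value : ℝ)).indicator hmiss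
  refine (integral_mono hX ((integrable_finsetSum _ fun j _ => hshare j).add hind)
    hpoint).trans_eq ?_
  simp only [Pi.add_apply]
  rw [integral_add (integrable_finsetSum _ fun j _ => hshare j) hind,
    integral_finsetSum _ fun j _ => hshare j, integral_indicator_const _ hmiss,
    probReal_compl_eq_one_sub (θ.measurableSet_hitSet A i), smul_eq_mul, mul_comm, hitProb]

lemma dependsOn_mul_apply :
    DependsOn (fun y : Fin m → ℝ≥0 => ((A i j * y j : ℝ≥0) : ℝ))
      (({j} : Finset (Fin m)) : Set (Fin m)) := fun y y' h => by
  have hj : y j = y' j := h j (by simp)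
  simp only [hj]

variable {H i} in
lemma dependsOn_share (hi : i ∉ H) :
    DependsOn (θ.share A H i j) (({j} : Finset (Fin m)) : Set (Fin m)) := fun y y' h => by
  have hj : y j = y' j := h j (by simp)
  classical
  simp only [share, shareSet, hi, if_false, Set.indicator_apply, Set.mem_ofPred_eq, hj]

section Shares

variable {θ A μ} {h : ℕ} {δ : ℝ} (hδ : (Measure.pi μ).real {y | h < θ.hitCount A y} ≤ δ)

include hδ

lemma setIntegral_compl_roomSet_le {j : Fin m} {f : (Fin m → ℝ≥0) → ℝ} (hf : Measurable f)
    (hf0 : 0 ≤ f) (hfj : DependsOn f (({j} : Finset (Fin m)) : Set (Fin m))) :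
    ∫ y in (θ.roomSet A j h)ᶜ, f y ∂Measure.pi μ ≤ δ * ∫ y, f y ∂Measure.pi μ := by
  rw [setIntegral_eq_mul_of_dependsOn μ hf (θ.measurableSet_roomSet A j h).compl hfj
    (θ.dependsOn_mem_compl_roomSet A j h) disjoint_compl_right]
  gcongr
  · exact integral_nonneg hf0
  · exact (measureReal_mono (θ.compl_roomSet_subset A j h)).trans hδ

variable {H i} in
lemma sum_setIntegral_compl_roomSet_share_le (hi : i ∈ H → 1 / 4 ≤ θ.hitProb A i μ)
    (hX : Integrable (fun y => ((A.mulVec y i : ℝ≥0) : ℝ)) (Measure.pi μ)) :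
    ∑ j, ∫ y in (θ.roomSet A j h)ᶜ, θ.share A H i j y ∂Measure.pi μ
      ≤ δ * (∑ j, ∫ y, θ.share A H i j y ∂Measure.pi μ + 4 * (θ.value * θ.hitProb A i μ)) := by
  have hδ0 : 0 ≤ δ := measureReal_nonneg.trans hδ
  have hp0 := θ.hitProb_nonneg A i μ
  by_cases hiH : i ∈ H
  · have hvalue : θ.value * (1 - θ.hitProb A i μ) ≤ 4 * (θ.value * θ.hitProb A i μ) := by
      nlinarith [mul_nonneg θ.value.coe_nonneg (sub_nonneg.2 (hi hiH))]
    calc ∑ j, ∫ y in (θ.roomSet A j h)ᶜ, θ.share A H i j y ∂Measure.pi μ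
        ≤ ∑ j, ∫ y in (θ.roomSet A j h)ᶜ, ((A i j * y j : ℝ≥0) : ℝ) ∂Measure.pi μ :=
          Finset.sum_le_sum fun j _ => setIntegral_mono (θ.integrable_share H j hX).integrableOn
            (integrable_mul_apply j hX).integrableOn (θ.share_le A H i j)
      _ ≤ ∑ j, δ * ∫ y, ((A i j * y j : ℝ≥0) : ℝ) ∂Measure.pi μ :=
          Finset.sum_le_sum fun j _ => setIntegral_compl_roomSet_le hδ (by fun_prop)
            (fun y => NNReal.coe_nonneg _) (dependsOn_mul_apply A i j)
      _ = δ * ∫ y, ((A.mulVec y i : ℝ≥0) : ℝ) ∂Measure.pi μ := by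
          simp only [coe_mulVec]
          rw [← Finset.mul_sum, integral_finsetSum _ fun j _ => integrable_mul_apply j hX]
      _ ≤ δ * (∑ j, ∫ y, θ.share A H i j y ∂Measure.pi μ + 4 * (θ.value * θ.hitProb A i μ)) := by
          gcongr
          exact (θ.integral_mulVec_le_sum_integral_share hiH hX).trans (by gcongr)
  · calc ∑ j, ∫ y in (θ.roomSet A j h)ᶜ, θ.share A H i j y ∂Measure.pi μ
        ≤ ∑ j, δ * ∫ y, θ.share A H i j y ∂Measure.pi μ :=
          Finset.sum_le_sum fun j _ => setIntegral_compl_roomSet_le hδ (θ.measurable_share A H i j)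
            (θ.share_nonneg A H i j) (θ.dependsOn_share A j hiH)
      _ ≤ δ * (∑ j, ∫ y, θ.share A H i j y ∂Measure.pi μ + 4 * (θ.value * θ.hitProb A i μ)) := by
          rw [← Finset.mul_sum]
          gcongr
          exact le_add_of_nonneg_right (by positivity)

variable {H} in
theorem le_sum_setIntegral_roomSet_share (hH : ∀ i ∈ H, 1 / 4 ≤ θ.hitProb A i μ)
    (hX : ∀ i, Integrable (fun y => ((A.mulVec y i : ℝ≥0) : ℝ)) (Measure.pi μ)) :
    (1 - δ) * ∑ i, ∑ j, ∫ y, θ.share A H i j y ∂Measure.pi μ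
        - 4 * δ * (θ.value * ∑ i, θ.hitProb A i μ)
      ≤ ∑ i, ∑ j, ∫ y in θ.roomSet A j h, θ.share A H i j y ∂Measure.pi μ := by
  have hlost := Finset.sum_le_sum fun i (_ : i ∈ Finset.univ) =>
    sum_setIntegral_compl_roomSet_share_le hδ (hH i) (hX i)
  have hsplit (i j) : ∫ y in (θ.roomSet A j h)ᶜ, θ.share A H i j y ∂Measure.pi μ
      = ∫ y, θ.share A H i j y ∂Measure.pi μ
        - ∫ y in θ.roomSet A j h, θ.share A H i j y ∂Measure.pi μ :=
    eq_sub_of_add_eq' (integral_add_compl (θ.measurableSet_roomSet A j h)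
      (θ.integrable_share H j (hX i)))
  simp only [hsplit, Finset.sum_sub_distrib, ← Finset.mul_sum, Finset.sum_add_distrib] at hlost
  linarith

end Shares

end Losses

end Threshold

/-! ### The expected reward of the threshold algorithms -/

section Benchmark

variable {n m : ℕ} (r : ℕ) (τ : ℝ≥0) (A : Matrix (Fin n) (Fin m) ℝ≥0)

/-- The upper bound `r τ + ∑ i, 𝔼[(X i - τ)⁺]` for the expected reward of the prophet. -/
def benchmark (P : Measure (Fin m → ℝ≥0)) : ℝ :=
  r * τ + ∑ i, ∫ y, ((A.mulVec y i - τ : ℝ≥0) : ℝ) ∂P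

variable {A} in
lemma integrable_mulVec_tsub {P : Measure (Fin m → ℝ≥0)} {i : Fin n}
    (hX : Integrable (fun y => ((A.mulVec y i : ℝ≥0) : ℝ)) P) :
    Integrable (fun y => ((A.mulVec y i - τ : ℝ≥0) : ℝ)) P :=
  hX.mono' ((measurable_mulVec_apply A i).sub_const τ).coe_nnreal_real.aestronglyMeasurable
    (ae_of_all _ fun y => by
      rw [Real.norm_of_nonneg (NNReal.coe_nonneg _)]
      exact_mod_cast tsub_le_self)

end Benchmark

namespace Threshold

section Reward

variable {n m r s : ℕ} (θ : Threshold n) {A : Matrix (Fin n) (Fin m) ℝ≥0} (H : Finset (Fin n))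
  {μ : Fin m → Measure ℝ≥0} [∀ j, IsProbabilityMeasure (μ j)]

lemma integrable_greedyReward {P : Measure (Fin m → ℝ≥0)}
    (hX : ∀ i, Integrable (fun y => ((A.mulVec y i : ℝ≥0) : ℝ)) P) (r : ℕ) (I : Finset (Fin n)) :
    Integrable (fun y => (θ.greedyReward r I (A.mulVec y) : ℝ)) P :=
  (integrable_finsetSum Finset.univ fun i _ => hX i).mono'
    ((θ.measurable_greedyReward r I).comp
      (measurable_mulVec A)).coe_nnreal_real.aestronglyMeasurable
    (ae_of_all _ fun y => by
      rw [Real.norm_of_nonneg (NNReal.coe_nonneg _)]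
      exact_mod_cast Finset.sum_le_sum_of_subset (Finset.subset_univ _))

lemma integrable_rest (i : Fin n) : Integrable (θ.rest A H i) (Measure.pi μ) :=
  (θ.memLp_rest A H i _ 1).integrable le_rfl

theorem sum_integral_share_add_integral_rest
    (hX : ∀ i, Integrable (fun y => ((A.mulVec y i : ℝ≥0) : ℝ)) (Measure.pi μ)) :
    ∑ i, ∑ j, ∫ y, θ.share A H i j y ∂Measure.pi μ
        + ∫ y, ∑ i, θ.rest A H i y ∂Measure.pi μ
      = θ.value * ∑ i, θ.hitProb A i μ
        + ∑ i, ∫ y, ((A.mulVec y i - θ.value : ℝ≥0) : ℝ) ∂Measure.pi μ := by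
  have hshare (i) := integrable_finsetSum Finset.univ fun j _ => θ.integrable_share H j (hX i)
  rw [integral_finsetSum _ fun i _ => θ.integrable_rest H i, Finset.mul_sum,
    ← Finset.sum_add_distrib, ← Finset.sum_add_distrib]
  refine Finset.sum_congr rfl fun i _ => ?_
  have hhit := θ.measurableSet_hitSet A i
  have hpoint (y) : ∑ j, θ.share A H i j y + θ.rest A H i y
      = (θ.hitSet A i).indicator (fun _ => (θ.value : ℝ)) y
        + ((A.mulVec y i - θ.value : ℝ≥0) : ℝ) := by
    rw [sum_share_add_rest]
    by_cases hy : y ∈ θ.hitSet A i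
    · rw [Set.indicator_of_mem hy, Set.indicator_of_mem hy,
        NNReal.coe_sub (θ.value_le_of_mem_accepts hy)]
      ring
    · have hle : A.mulVec y i ≤ θ.value := not_lt.1 fun h => hy (mem_hitSet_of_value_lt h)
      simp [hy, tsub_eq_zero_of_le hle]
  calc ∑ j, ∫ y, θ.share A H i j y ∂Measure.pi μ + ∫ y, θ.rest A H i y ∂Measure.pi μ
      = ∫ y, (∑ j, θ.share A H i j y + θ.rest A H i y) ∂Measure.pi μ := by
        rw [integral_add (hshare i) (θ.integrable_rest H i),
          integral_finsetSum _ fun j _ => θ.integrable_share H j (hX i)]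
    _ = θ.value * θ.hitProb A i μ
          + ∫ y, ((A.mulVec y i - θ.value : ℝ≥0) : ℝ) ∂Measure.pi μ := by
        simp only [hpoint]
        rw [integral_add ((integrable_const _).indicator hhit)
          (integrable_mulVec_tsub θ.value (hX i)), integral_indicator_const _ hhit, smul_eq_mul,
          mul_comm, hitProb]

variable {H} in
lemma setIntegral_rest_le (hA : colSparsity A ≤ s) (hH : ∀ i ∉ H, θ.hitProb A i μ ≤ 1 / 4)
    (hr : 0 < r) (hE : ∑ i, θ.hitProb A i μ ≤ r) {u : ℝ} (hsu : s ≤ u * r)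
    {B : Set (Fin m → ℝ≥0)} (hB : (Measure.pi μ).real B ≤ u) :
    ∫ y in B, ∑ i, θ.rest A H i y ∂Measure.pi μ
      ≤ u * ∫ y, ∑ i, θ.rest A H i y ∂Measure.pi μ + 21 * u * (r * θ.value) := by
  set F := fun y => ∑ i, θ.rest A H i y
  have hF0 (y) : 0 ≤ F y := Finset.sum_nonneg fun i _ => θ.rest_nonneg A H i y
  have hEF : 0 ≤ ∫ y, F y ∂Measure.pi μ := integral_nonneg hF0
  have hu : 0 ≤ u := measureReal_nonneg.trans hB
  obtain hτ | hτ := eq_zero_or_pos θ.value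
  · have hF : F = 0 := funext fun y => (hF0 y).antisymm' (Finset.sum_nonpos fun i _ => by
      simpa [hτ] using θ.rest_le A H i y)
    simp [hF, hτ]
  have hE0 : 0 ≤ ∑ i, θ.hitProb A i μ := Finset.sum_nonneg fun i _ => θ.hitProb_nonneg A i μ
  set c : ℝ := r * θ.value
  have hc : 0 < c := mul_pos (Nat.cast_pos.2 hr) (NNReal.coe_pos.2 hτ)
  have hvar : Var[F; Measure.pi μ] ≤ 40 * u * c ^ 2 := by
    calc Var[F; Measure.pi μ] ≤ s * (40 * (θ.value : ℝ) ^ 2 * ∑ i, θ.hitProb A i μ) :=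
          θ.variance_sum_rest_le A hA hH
      _ ≤ (u * r) * (40 * (θ.value : ℝ) ^ 2 * r) := by gcongr
      _ = 40 * u * c ^ 2 := by ring
  have htail := two_mul_setIntegral_le (P := Measure.pi μ)
    (memLp_finsetSum Finset.univ fun i _ => θ.memLp_rest A H i (Measure.pi μ) 2) B c
  have hBu : (2 * c * ∫ y, F y ∂Measure.pi μ + c ^ 2) * (Measure.pi μ).real B
      ≤ (2 * c * ∫ y, F y ∂Measure.pi μ + c ^ 2) * u := by gcongr
  have huc : 0 ≤ u * c ^ 2 := by positivity
  refine le_of_mul_le_mul_left ?_ (mul_pos two_pos hc)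
  linarith

variable {H} in
lemma le_setIntegral_rest (hA : colSparsity A ≤ s) (hH : ∀ i ∉ H, θ.hitProb A i μ ≤ 1 / 4)
    (hr : 0 < r) (hE : ∑ i, θ.hitProb A i μ ≤ r) {u : ℝ} (hsu : s ≤ u * r)
    {G : Set (Fin m → ℝ≥0)} (hG : MeasurableSet G) (hGu : (Measure.pi μ).real Gᶜ ≤ u) :
    (1 - u) * ∫ y, ∑ i, θ.rest A H i y ∂Measure.pi μ - 21 * u * (r * θ.value)
      ≤ ∫ y in G, ∑ i, θ.rest A H i y ∂Measure.pi μ := by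
  have hlost := θ.setIntegral_rest_le hA hH hr hE hsu hGu
  have hsplit := integral_add_compl hG
    (integrable_finsetSum Finset.univ fun i _ => θ.integrable_rest (A := A) (μ := μ) H i)
  linarith

lemma sum_setIntegral_add_le_integral_greedyReward (hA : colSparsity A ≤ s) (hsr : s ≤ r)
    (hX : ∀ i, Integrable (fun y => ((A.mulVec y i : ℝ≥0) : ℝ)) (Measure.pi μ)) :
    ∑ i, ∑ j, ∫ y in θ.roomSet A j (r - s), θ.share A H i j y ∂Measure.pi μ
        + ∫ y in {y | θ.hitCount A y ≤ r}, ∑ i, θ.rest A H i y ∂Measure.pi μ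
      ≤ ∫ y, (θ.greedyReward r Finset.univ (A.mulVec y) : ℝ) ∂Measure.pi μ := by
  have hroom (j) := θ.measurableSet_roomSet A j (r - s)
  have hcount : MeasurableSet {y | θ.hitCount A y ≤ r} :=
    measurableSet_le (θ.measurable_hitCount A) measurable_const
  have hshare (i j) := (θ.integrable_share H j (hX i)).indicator (hroom j)
  have hrest (i) := (θ.integrable_rest (A := A) (μ := μ) H i).indicator hcount
  have hmono := integral_mono (integrable_finsetSum Finset.univ fun i _ =>
      (integrable_finsetSum Finset.univ fun j _ => hshare i j).add (hrest i))
    (θ.integrable_greedyReward hX r Finset.univ)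
    fun y => θ.sum_indicator_share_add_rest_le_greedyReward H y hA hsr
  refine le_of_eq_of_le ?_ hmono
  rw [integral_finsetSum _ fun i _ => θ.integrable_rest H i |>.integrableOn,
    ← Finset.sum_add_distrib, integral_finsetSum _ fun i _ =>
      (integrable_finsetSum Finset.univ fun j _ => hshare i j).add (hrest i)]
  refine Finset.sum_congr rfl fun i _ => ?_
  simp only [Pi.add_apply]
  rw [integral_add (integrable_finsetSum Finset.univ fun j _ => hshare i j) (hrest i),
    integral_finsetSum _ fun j _ => hshare i j, integral_indicator hcount]
  simp only [integral_indicator (hroom _)]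

lemma measureReal_sub_lt_hitCount_le (hA : colSparsity A ≤ s) (hsr : s ≤ r) {u : ℝ}
    (hru : 0 < u * r) (hsu : s ≤ u ^ 3 * r) (hsu' : s ≤ u * r)
    (hE : ∑ i, θ.hitProb A i μ ≤ (1 - 2 * u) * r) (hE' : ∑ i, θ.hitProb A i μ ≤ r) :
    (Measure.pi μ).real {y | r - s < θ.hitCount A y} ≤ u := by
  have hgap : ∑ i, θ.hitProb A i μ + u * r ≤ (r - s : ℕ) := by
    rw [Nat.cast_sub hsr]
    linarith
  refine le_of_mul_le_mul_left ?_ (pow_pos hru 2)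
  calc (u * r) ^ 2 * (Measure.pi μ).real {y | r - s < θ.hitCount A y}
      ≤ s * ∑ i, θ.hitProb A i μ := θ.sq_mul_measureReal_lt_hitCount_le μ hA hru hgap
    _ ≤ (u ^ 3 * r) * r := by
        have := Finset.sum_nonneg fun i (_ : i ∈ Finset.univ) => θ.hitProb_nonneg A i μ
        gcongr
        exact (Nat.cast_nonneg s).trans hsu
    _ = (u * r) ^ 2 * u := by ring

theorem le_integral_greedyReward (hA : colSparsity A ≤ s) (hsr : s ≤ r) (hr : 0 < r)
    (hX : ∀ i, Integrable (fun y => ((A.mulVec y i : ℝ≥0) : ℝ)) (Measure.pi μ))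
    (hE : ∑ i, θ.hitProb A i μ ≤ r) {u : ℝ} (hsu : s ≤ u * r)
    (htail : (Measure.pi μ).real {y | r - s < θ.hitCount A y} ≤ u) :
    (1 - u) * (θ.value * ∑ i, θ.hitProb A i μ
          + ∑ i, ∫ y, ((A.mulVec y i - θ.value : ℝ≥0) : ℝ) ∂Measure.pi μ)
        - 4 * u * (θ.value * ∑ i, θ.hitProb A i μ) - 21 * u * (r * θ.value)
      ≤ ∫ y, (θ.greedyReward r Finset.univ (A.mulVec y) : ℝ) ∂Measure.pi μ := by
  have hover : (Measure.pi μ).real {y | θ.hitCount A y ≤ r}ᶜ ≤ u :=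
    (measureReal_mono fun y hy => (Nat.sub_le r s).trans_lt (not_le.1 hy)).trans htail
  have hshares := θ.le_sum_setIntegral_roomSet_share htail
    (fun i hi => mem_likely.1 hi) hX
  have hrest := θ.le_setIntegral_rest hA
    (fun i hi => (not_le.1 fun h => hi (mem_likely.2 h)).le) hr hE hsu
    (measurableSet_le (θ.measurable_hitCount A) measurable_const) hover
  have hreward := θ.sum_setIntegral_add_le_integral_greedyReward (θ.likely A μ) hA hsr hX
  rw [← θ.sum_integral_share_add_integral_rest (θ.likely A μ) hX]
  linarith

theorem mul_benchmark_le_integral_greedyReward (hA : colSparsity A ≤ s) {u : ℝ} (hu : u ≤ 1)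
    (hru : 1 ≤ u * r) (hsu : s ≤ u ^ 3 * r)
    (hX : ∀ i, Integrable (fun y => ((A.mulVec y i : ℝ≥0) : ℝ)) (Measure.pi μ))
    (hE : ∑ i, θ.hitProb A i μ ≤ (1 - 2 * u) * r)
    (hτ : θ.value = 0 ∨ (1 - 2 * u) * r ≤ ∑ i, θ.hitProb A i μ + 1) :
    (1 - 29 * u) * benchmark r θ.value A (Measure.pi μ)
      ≤ ∫ y, (θ.greedyReward r Finset.univ (A.mulVec y) : ℝ) ∂Measure.pi μ := by
  set E := ∑ i, θ.hitProb A i μ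
  have hur : 0 < u * r := one_pos.trans_le hru
  have hr0 : (0 : ℝ) ≤ r := r.cast_nonneg
  have hu0 : 0 < u := pos_of_mul_pos_left hur hr0
  have hr : (0 : ℝ) < r := pos_of_mul_pos_right hur hu0.le
  have hsu' : (s : ℝ) ≤ u * r :=
    hsu.trans (mul_le_mul_of_nonneg_right (pow_le_of_le_one hu0.le hu three_ne_zero) hr0)
  have hsr : s ≤ r := by exact_mod_cast hsu'.trans (mul_le_of_le_one_left hr0 hu)
  have hEr : E ≤ r := by linarith
  have hreward := θ.le_integral_greedyReward hA hsr (Nat.cast_pos.1 hr) hX hEr hsu'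
    (θ.measureReal_sub_lt_hitCount_le hA hsr hur hsu hsu' hE hEr)
  have hτr : θ.value * ((1 - 3 * u) * r) ≤ θ.value * E := by
    obtain h | h := hτ
    · simp [h]
    · gcongr
      linarith
  have hV : 0 ≤ u * ∑ i, ∫ y, ((A.mulVec y i - θ.value : ℝ≥0) : ℝ) ∂Measure.pi μ :=
    mul_nonneg hu0.le (Finset.sum_nonneg fun i _ => integral_nonneg fun y => NNReal.coe_nonneg _)
  have hcollected : (1 - 4 * u) * (r * θ.value) ≤ (1 - u) * (θ.value * E) := by
    have hsq : 0 ≤ u ^ 2 * (r * (θ.value : ℝ)) := by positivity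
    linarith [mul_le_mul_of_nonneg_left hτr (sub_nonneg.2 hu)]
  have hlost : u * (θ.value * E) ≤ u * (r * θ.value) := by
    rw [mul_comm (r : ℝ)]
    gcongr
  rw [benchmark]
  linarith

end Reward

section ConstantFactor

/-- The rule that accepts every value: with threshold `0`, all arrivals may be tied. -/
def acceptAll (n : ℕ) : Threshold n := ⟨0, Finset.univ⟩

variable {n m r s : ℕ} (θ : Threshold n) {A : Matrix (Fin n) (Fin m) ℝ≥0} {H : Finset (Fin n)}
  {μ : Fin m → Measure ℝ≥0}

lemma apply_le_greedyReward_singleton (hr : 0 < r) (i : Fin n) (x : Fin n → ℝ≥0) :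
    x i ≤ (acceptAll n).greedyReward r {i} x := by
  have haccepts : x i ∈ (acceptAll n).accepts i := by
    simpa [acceptAll, accepts] using (zero_le (a := x i)).lt_or_eq.imp_right Eq.symm
  have hcard : ((acceptAll n).candidates {i} x).card ≤ 1 := by
    classical exact Finset.card_filter_le _ _
  exact Finset.single_le_sum (fun _ _ => zero_le)
    (mem_greedySelect_of_card_le (Finset.mem_singleton_self i) haccepts (hcard.trans hr))

lemma mul_measureReal_eq_le_integral_greedyReward {P : Measure (Fin m → ℝ≥0)} [IsFiniteMeasure P]
    (hr : 0 < r) (hX : ∀ i, Integrable (fun y => ((A.mulVec y i : ℝ≥0) : ℝ)) P) (i : Fin n)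
    (τ : ℝ≥0) :
    τ * P.real {y | A.mulVec y i = τ}
      ≤ ∫ y, ((acceptAll n).greedyReward r {i} (A.mulVec y) : ℝ) ∂P :=
  calc τ * P.real {y | A.mulVec y i = τ}
      ≤ τ * P.real {y | (τ : ℝ) ≤ A.mulVec y i} := by
        refine mul_le_mul_of_nonneg_left (measureReal_mono fun y hy => ?_) τ.coe_nonneg
        have heq : A.mulVec y i = τ := hy
        exact NNReal.coe_le_coe.2 heq.ge
    _ ≤ ∫ y, ((A.mulVec y i : ℝ≥0) : ℝ) ∂P :=
        mul_meas_ge_le_integral_of_nonneg (ae_of_all _ fun y => NNReal.coe_nonneg _) (hX i) τ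
    _ ≤ ∫ y, ((acceptAll n).greedyReward r {i} (A.mulVec y) : ℝ) ∂P :=
        integral_mono (hX i) (integrable_greedyReward _ hX r {i}) fun y =>
          NNReal.coe_le_coe.2 (apply_le_greedyReward_singleton hr i _)

lemma sub_sq_div_le_min (N : ℝ) {r : ℝ} (hr : 0 < r) : N - N ^ 2 / (4 * r) ≤ min N r := by
  refine le_min (sub_le_self _ (by positivity)) ?_
  have hsq : r - (N - N ^ 2 / (4 * r)) = (N - 2 * r) ^ 2 / (4 * r) := by
    field_simp
    ring
  exact sub_nonneg.1 (hsq ▸ by positivity)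

lemma sum_setIntegral_roomSet_share_le {P : Measure (Fin m → ℝ≥0)}
    (hA : colSparsity A ≤ r) {h : ℕ} (hh : 2 * h < r)
    (hX : ∀ i, Integrable (fun y => ((A.mulVec y i : ℝ≥0) : ℝ)) P) {M : ℝ}
    (hM : ∀ I, ∫ y, (θ.greedyReward r I (A.mulVec y) : ℝ) ∂P ≤ M) :
    ∑ i, ∑ j, ∫ y in θ.roomSet A j h, θ.share A H i j y ∂P ≤ 4 * M := by
  have hshare (i j) := (θ.integrable_share H j (hX i)).indicator (θ.measurableSet_roomSet A j h)
  have hreward (I : Finset (Fin n)) := θ.integrable_greedyReward hX r I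
  have hmono := integral_mono
    ((integrable_finsetSum Finset.univ fun i _ =>
      integrable_finsetSum Finset.univ fun j _ => hshare i j).const_mul (2 ^ n))
    ((integrable_finsetSum Finset.univ fun I _ => hreward I).const_mul 4)
    fun y => θ.two_pow_mul_sum_indicator_share_le H y hA hh
  have hroom : ∫ y, ∑ i, ∑ j, (θ.roomSet A j h).indicator (θ.share A H i j) y ∂P
      = ∑ i, ∑ j, ∫ y in θ.roomSet A j h, θ.share A H i j y ∂P := by
    rw [integral_finsetSum _ fun i _ => integrable_finsetSum Finset.univ fun j _ => hshare i j]
    refine Finset.sum_congr rfl fun i _ => ?_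
    rw [integral_finsetSum _ fun j _ => hshare i j]
    exact Finset.sum_congr rfl fun j _ => integral_indicator (θ.measurableSet_roomSet A j h)
  have haverage :
      ∑ I, ∫ y, (θ.greedyReward r I (A.mulVec y) : ℝ) ∂P ≤ 2 ^ n * M := by
    simpa using Finset.sum_le_card_nsmul Finset.univ _ M fun I _ => hM I
  rw [integral_const_mul, integral_const_mul, integral_finsetSum _ fun I _ => hreward I,
    hroom] at hmono
  refine le_of_mul_le_mul_left ?_ (pow_pos (two_pos (α := ℝ)) n)
  linarith

variable [∀ j, IsProbabilityMeasure (μ j)]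

lemma integral_hitCount_sq_le (hA : colSparsity A ≤ s) :
    ∫ y, (θ.hitCount A y : ℝ) ^ 2 ∂Measure.pi μ
      ≤ s * ∑ i, θ.hitProb A i μ + (∑ i, θ.hitProb A i μ) ^ 2 := by
  have hvar := θ.variance_hitCount_le μ hA
  rw [variance_eq_sub (θ.memLp_hitCount A μ), integral_hitCount] at hvar
  exact sub_le_iff_le_add.1 hvar

lemma mul_value_mul_sum_hitProb_le_integral_greedyReward (hA : colSparsity A ≤ r) (hr : 0 < r)
    (hX : ∀ i, Integrable (fun y => ((A.mulVec y i : ℝ≥0) : ℝ)) (Measure.pi μ))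
    (hE : ∑ i, θ.hitProb A i μ ≤ r / 8) :
    23 / 32 * (θ.value * ∑ i, θ.hitProb A i μ)
      ≤ ∫ y, (θ.greedyReward r Finset.univ (A.mulVec y) : ℝ) ∂Measure.pi μ := by
  set E := ∑ i, θ.hitProb A i μ
  have hr' : (0 : ℝ) < r := Nat.cast_pos.2 hr
  have hE0 : 0 ≤ E := Finset.sum_nonneg fun i _ => θ.hitProb_nonneg A i μ
  have hcount := (θ.memLp_hitCount A μ).integrable one_le_two
  have hcount2 := (θ.memLp_hitCount A μ).integrable_sq.div_const (4 * (r : ℝ))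
  have hsq : (∫ y, (θ.hitCount A y : ℝ) ^ 2 ∂Measure.pi μ) / (4 * r) ≤ 9 / 32 * E := by
    rw [div_le_iff₀ (by positivity)]
    linarith [θ.integral_hitCount_sq_le (μ := μ) hA, mul_le_mul_of_nonneg_right hE hE0]
  calc 23 / 32 * (θ.value * E)
      ≤ θ.value * (E - (∫ y, (θ.hitCount A y : ℝ) ^ 2 ∂Measure.pi μ) / (4 * r)) := by
        rw [mul_left_comm]
        gcongr
        linarith
    _ = ∫ y, θ.value * ((θ.hitCount A y : ℝ) - (θ.hitCount A y : ℝ) ^ 2 / (4 * r))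
          ∂Measure.pi μ := by
        rw [integral_const_mul, integral_sub hcount hcount2, integral_div, integral_hitCount]
    _ ≤ ∫ y, (θ.greedyReward r Finset.univ (A.mulVec y) : ℝ) ∂Measure.pi μ := by
        refine integral_mono ((hcount.sub hcount2).const_mul _)
          (θ.integrable_greedyReward hX r Finset.univ) fun y => ?_
        calc θ.value * ((θ.hitCount A y : ℝ) - (θ.hitCount A y : ℝ) ^ 2 / (4 * r))
            ≤ θ.value * min (θ.hitCount A y : ℝ) r := by
              gcongr
              exact sub_sq_div_le_min _ hr'
          _ ≤ θ.greedyReward r Finset.univ (A.mulVec y) := by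
              exact_mod_cast value_mul_min_le_greedyReward

lemma integral_sum_rest_le (hH : ∀ i ∉ H, θ.hitProb A i μ ≤ 1 / 4) :
    ∫ y, ∑ i, θ.rest A H i y ∂Measure.pi μ ≤ 21 * (θ.value * ∑ i, θ.hitProb A i μ) := by
  rw [integral_finsetSum _ fun i _ => θ.integrable_rest H i, Finset.mul_sum, Finset.mul_sum]
  exact Finset.sum_le_sum fun i _ => θ.integral_rest_le A (hH i)

theorem benchmark_le_of_forall_integral_greedyReward_le (hA : colSparsity A ≤ r) (hr : 0 < r)
    (hX : ∀ i, Integrable (fun y => ((A.mulVec y i : ℝ≥0) : ℝ)) (Measure.pi μ))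
    (hE : ∑ i, θ.hitProb A i μ ≤ r / 8)
    (hτ : θ.value = 0 ∨ ∃ i₀, r / 8 ≤ ∑ i, θ.hitProb A i μ
      + (Measure.pi μ).real {y | A.mulVec y i₀ = θ.value}) {M : ℝ}
    (hM : ∀ (θ : Threshold n) (I : Finset (Fin n)),
      ∫ y, (θ.greedyReward r I (A.mulVec y) : ℝ) ∂Measure.pi μ ≤ M) :
    benchmark r θ.value A (Measure.pi μ) ≤ 55 * M := by
  have hM0 : 0 ≤ M := (integral_nonneg fun y => NNReal.coe_nonneg _).trans (hM θ ∅)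
  have hcount := (θ.mul_value_mul_sum_hitProb_le_integral_greedyReward hA hr hX hE).trans (hM θ _)
  have hδ : (Measure.pi μ).real {y | (r - 1) / 2 < θ.hitCount A y} ≤ 1 / 4 := by
    have hmarkov := θ.mul_measureReal_lt_hitCount_le A μ ((r - 1) / 2)
    have hhalf : (r / 2 : ℝ) ≤ ((r - 1) / 2 : ℕ) + 1 := by
      rw [div_le_iff₀ two_pos]
      exact_mod_cast (by omega : r ≤ ((r - 1) / 2 + 1) * 2)
    refine le_of_mul_le_mul_left ?_ (half_pos (Nat.cast_pos.2 hr : (0 : ℝ) < r))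
    linarith [mul_le_mul_of_nonneg_right hhalf (measureReal_nonneg (μ := Measure.pi μ)
      (s := {y | (r - 1) / 2 < θ.hitCount A y}))]
  have hshares := (θ.le_sum_setIntegral_roomSet_share hδ (fun i hi => mem_likely.1 hi) hX).trans
    (θ.sum_setIntegral_roomSet_share_le hA (by omega) hX (hM θ))
  have hrest := θ.integral_sum_rest_le (H := θ.likely A μ)
    (fun i hi => (not_le.1 fun h => hi (mem_likely.2 h)).le)
  have hsum := θ.sum_integral_share_add_integral_rest (θ.likely A μ) hX
  have hτr : θ.value * r ≤ 8 * (θ.value * ∑ i, θ.hitProb A i μ + M) := by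
    obtain h | ⟨i₀, hi₀⟩ := hτ
    · simpa [h] using hM0
    · have htie := (mul_measureReal_eq_le_integral_greedyReward hr hX i₀ θ.value).trans
        (hM (acceptAll n) {i₀})
      linarith [mul_le_mul_of_nonneg_left hi₀ θ.value.coe_nonneg]
  rw [benchmark]
  linarith

theorem exists_benchmark_le_integral_greedyReward (hA : colSparsity A ≤ r) (hr : 0 < r)
    (hX : ∀ i, Integrable (fun y => ((A.mulVec y i : ℝ≥0) : ℝ)) (Measure.pi μ))
    (hE : ∑ i, θ.hitProb A i μ ≤ r / 8)
    (hτ : θ.value = 0 ∨ ∃ i₀, r / 8 ≤ ∑ i, θ.hitProb A i μ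
      + (Measure.pi μ).real {y | A.mulVec y i₀ = θ.value}) :
    ∃ (θ' : Threshold n) (I : Finset (Fin n)), benchmark r θ.value A (Measure.pi μ)
      ≤ 60 * ∫ y, (θ'.greedyReward r I (A.mulVec y) : ℝ) ∂Measure.pi μ := by
  by_contra! hlt
  have hpos : 0 < benchmark r θ.value A (Measure.pi μ) :=
    lt_of_le_of_lt (mul_nonneg (by norm_num) (integral_nonneg fun y => NNReal.coe_nonneg _))
      (hlt θ ∅)
  have hle := θ.benchmark_le_of_forall_integral_greedyReward_le hA hr hX hE hτ
    fun θ' I => ((le_div_iff₀' (by norm_num)).2 (hlt θ' I).le)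
  linarith

end ConstantFactor

end Threshold

/-! ### The prophet and the approximation ratio -/

section Prophet

lemma sum_take_le_mul_add_sum_tsub (τ : ℝ≥0) (l : List ℝ≥0) (r : ℕ) :
    (l.take r).sum ≤ r * τ + (l.map fun x => x - τ).sum := by
  induction l generalizing r with
  | nil => simp
  | cons x l ih =>
    cases r with
    | zero => simp
    | succ r =>
      simp only [List.take_succ_cons, List.sum_cons, List.map_cons]
      calc x + (l.take r).sum ≤ (τ + (x - τ)) + (r * τ + (l.map fun x => x - τ).sum) :=
            add_le_add le_add_tsub (ih r)
        _ = _ := by push_cast; ring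

lemma opt_le_mul_add_sum_tsub {n : ℕ} (r : ℕ) (τ : ℝ≥0) (x : Fin n → ℝ≥0) :
    opt r x ≤ r * τ + ∑ i, (x i - τ) := by
  refine (sum_take_le_mul_add_sum_tsub τ _ r).trans_eq ?_
  rw [((List.mergeSort_perm (List.ofFn x) _).map _).sum_eq, List.map_ofFn, List.sum_ofFn]
  rfl

variable {n m : ℕ} {A : Matrix (Fin n) (Fin m) ℝ≥0} {μ : Fin m → Measure ℝ≥0}

lemma expectedOpt_eq_zero (hA : colSparsity A = 0) (r : ℕ) : expectedOpt r A μ = 0 := by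
  have hA0 (i j) : A i j = 0 := by
    by_contra hne
    have hcard := Finset.card_pos.2 ⟨i, mem_colSupport.2 hne⟩
    exact (hcard.trans_le (card_colSupport_le A j)).ne' hA
  have hX (y) (i) : A.mulVec y i = 0 := by simp [Matrix.mulVec, dotProduct, hA0]
  have hopt (y) : opt r (A.mulVec y) = 0 := by
    simpa [hX] using opt_le_mul_add_sum_tsub r 0 (A.mulVec y)
  simp [expectedOpt, hopt]

lemma expectedReward_greedy_acceptAll_eq_top {r : ℕ} (hr : 0 < r) {i : Fin n}
    (hX : ¬ Integrable (fun y => ((A.mulVec y i : ℝ≥0) : ℝ)) (Measure.pi μ)) :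
    expectedReward ((Threshold.acceptAll n).greedy r {i}) A μ = ∞ := by
  have htop : ∫⁻ y, ((A.mulVec y i : ℝ≥0) : ℝ≥0∞) ∂Measure.pi μ = ∞ := by
    by_contra hne
    refine hX ((lintegral_ofReal_ne_top_iff_integrable
      (measurable_mulVec_apply A i).coe_nnreal_real.aestronglyMeasurable
      (ae_of_all _ fun y => NNReal.coe_nonneg _)).1 ?_)
    simpa only [ENNReal.ofReal_coe_nnreal] using hne
  rw [Threshold.expectedReward_greedy, eq_top_iff, ← htop]
  exact lintegral_mono fun y =>
    ENNReal.coe_le_coe.2 (Threshold.apply_le_greedyReward_singleton hr i _)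

variable [∀ j, IsProbabilityMeasure (μ j)]

lemma expectedOpt_le_ofReal_benchmark (r : ℕ) (τ : ℝ≥0)
    (hX : ∀ i, Integrable (fun y => ((A.mulVec y i : ℝ≥0) : ℝ)) (Measure.pi μ)) :
    expectedOpt r A μ ≤ ENNReal.ofReal (benchmark r τ A (Measure.pi μ)) := by
  have hexcess (i) := integrable_mulVec_tsub τ (hX i)
  have hsum := integrable_finsetSum Finset.univ fun i _ => hexcess i
  have hbenchmark : benchmark r τ A (Measure.pi μ)
      = ∫ y, (r * τ + ∑ i, ((A.mulVec y i - τ : ℝ≥0) : ℝ)) ∂Measure.pi μ := by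
    rw [integral_add (integrable_const _) hsum, integral_finsetSum _ fun i _ => hexcess i]
    simp [benchmark]
  have hbound : Integrable (fun y => r * τ + ∑ i, ((A.mulVec y i - τ : ℝ≥0) : ℝ))
      (Measure.pi μ) := (integrable_const _).add hsum
  rw [hbenchmark, ofReal_integral_eq_lintegral_ofReal hbound (ae_of_all _ fun y => by positivity)]
  refine lintegral_mono fun y => ?_
  rw [← ENNReal.ofReal_coe_nnreal]
  exact ENNReal.ofReal_le_ofReal (by exact_mod_cast opt_le_mul_add_sum_tsub r τ (A.mulVec y))

lemma Threshold.ofReal_mul_expectedOpt_le_expectedReward_greedy (θ : Threshold n) {r : ℕ}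
    {I : Finset (Fin n)} {τ : ℝ≥0} {κ : ℝ} (hκ : 0 ≤ κ)
    (hX : ∀ i, Integrable (fun y => ((A.mulVec y i : ℝ≥0) : ℝ)) (Measure.pi μ))
    (h : κ * benchmark r τ A (Measure.pi μ)
      ≤ ∫ y, (θ.greedyReward r I (A.mulVec y) : ℝ) ∂Measure.pi μ) :
    ENNReal.ofReal κ * expectedOpt r A μ ≤ expectedReward (θ.greedy r I) A μ :=
  calc ENNReal.ofReal κ * expectedOpt r A μ
      ≤ ENNReal.ofReal κ * ENNReal.ofReal (benchmark r τ A (Measure.pi μ)) := by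
        gcongr
        exact expectedOpt_le_ofReal_benchmark r τ hX
    _ ≤ ENNReal.ofReal (∫ y, (θ.greedyReward r I (A.mulVec y) : ℝ) ∂Measure.pi μ) := by
        rw [← ENNReal.ofReal_mul hκ]
        exact ENNReal.ofReal_le_ofReal h
    _ = expectedReward (θ.greedy r I) A μ := by
        rw [expectedReward_greedy, ofReal_integral_eq_lintegral_ofReal
          (θ.integrable_greedyReward hX r I) (ae_of_all _ fun y => NNReal.coe_nonneg _)]
        simp only [ENNReal.ofReal_coe_nnreal]

end Prophet

section Approximation

variable {s r : ℕ}

lemma admitsApproximation_zero (r : ℕ) (α : ℝ) : AdmitsApproximation 0 r α := by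
  intro n m A μ _ hA
  refine ⟨(Threshold.acceptAll n).greedy r ∅, ?_⟩
  rw [expectedOpt_eq_zero (Nat.le_zero.1 hA), mul_zero]
  exact zero_le

lemma AdmitsApproximation.mono {α β : ℝ} (h : AdmitsApproximation s r α) (hα : 0 < α)
    (hαβ : α ≤ β) : AdmitsApproximation s r β := by
  intro n m A μ hμ hA
  obtain ⟨alg, halg⟩ := h n m A μ hμ hA
  refine ⟨alg, le_trans ?_ halg⟩
  gcongr

/-- A single arrival already yields an infinite reward unless all arrivals are integrable. -/
lemma admitsApproximation_of_integrable {α : ℝ} (hr : 0 < r) (hα : 0 < α)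
    (h : ∀ (n m : ℕ) (A : Matrix (Fin n) (Fin m) ℝ≥0) (μ : Fin m → Measure ℝ≥0)
      [∀ j, IsProbabilityMeasure (μ j)], colSparsity A ≤ s →
      (∀ i, Integrable (fun y => ((A.mulVec y i : ℝ≥0) : ℝ)) (Measure.pi μ)) →
      ∃ (θ : Threshold n) (I : Finset (Fin n)) (τ : ℝ≥0), benchmark r τ A (Measure.pi μ)
        ≤ α * ∫ y, (θ.greedyReward r I (A.mulVec y) : ℝ) ∂Measure.pi μ) :
    AdmitsApproximation s r α := by
  intro n m A μ _ hA
  by_cases hX : ∀ i, Integrable (fun y => ((A.mulVec y i : ℝ≥0) : ℝ)) (Measure.pi μ)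
  · obtain ⟨θ, I, τ, hθ⟩ := h n m A μ hA hX
    exact ⟨θ.greedy r I, θ.ofReal_mul_expectedOpt_le_expectedReward_greedy (by positivity) hX
      ((div_mul_eq_mul_div _ _ _).trans_le (by rwa [one_mul, div_le_iff₀' hα]))⟩
  · obtain ⟨i, hi⟩ := not_forall.1 hX
    exact ⟨(Threshold.acceptAll n).greedy r {i},
      (expectedReward_greedy_acceptAll_eq_top hr hi).symm ▸ le_top⟩

theorem admitsApproximation_of_le_cube_mul {u : ℝ} (hu : u < 1 / 29) (hru : 1 ≤ u * r)
    (hsu : s ≤ u ^ 3 * r) : AdmitsApproximation s r (1 - 29 * u)⁻¹ := by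
  have hr : (0 : ℝ) < r := r.cast_nonneg.lt_of_ne fun h => by norm_num [← h] at hru
  have hκ : 0 < 1 - 29 * u := by linarith
  refine admitsApproximation_of_integrable (Nat.cast_pos.1 hr) (inv_pos.2 hκ)
    fun n m A μ _ hA hX => ?_
  obtain ⟨θ, hE, hτ⟩ := exists_threshold (P := Measure.pi μ) (measurable_mulVec_apply A)
    (mul_pos (by linarith : 0 < 1 - 2 * u) hr)
  refine ⟨θ, Finset.univ, θ.value, ?_⟩
  rw [le_inv_mul_iff₀ hκ]
  refine θ.mul_benchmark_le_integral_greedyReward hA (by linarith) hru hsu hX hE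
    (hτ.imp_right ?_)
  rintro ⟨i, hi⟩
  exact hi.trans (add_le_add_right measureReal_le_one _)

theorem admitsApproximation_sixty (hr : 0 < r) (hsr : s ≤ r) : AdmitsApproximation s r 60 := by
  refine admitsApproximation_of_integrable hr (by norm_num) fun n m A μ _ hA hX => ?_
  obtain ⟨θ, hE, hτ⟩ := exists_threshold (P := Measure.pi μ) (measurable_mulVec_apply A)
    (by positivity : (0 : ℝ) < r / 8)
  obtain ⟨θ', I, h⟩ := θ.exists_benchmark_le_integral_greedyReward (hA.trans hsr) hr hX hE hτ
  exact ⟨θ', I, θ.value, h⟩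

theorem tendsto_approxRatio (C : ℝ) (s : ℕ) :
    Tendsto (fun r : ℕ => approxRatio C s r) atTop (𝓝 1) := by
  have hlog := (isLittleO_log_rpow_rpow_atTop (6 / 5 : ℝ)
    (by norm_num : (0 : ℝ) < 1 / 5)).tendsto_div_nhds_zero.comp
      (tendsto_natCast_atTop_atTop (R := ℝ))
  have hratio := (hlog.const_mul (C * (s : ℝ) ^ (1 / 5 : ℝ))).const_add 1
  rw [mul_zero, add_zero] at hratio
  refine hratio.congr fun r => ?_
  simp only [approxRatio, Function.comp_apply]
  rw [Real.div_rpow s.cast_nonneg r.cast_nonneg]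
  ring

lemma two_fifths_le_log_rpow {x : ℝ} (hx : 2 ≤ x) : 2 / 5 ≤ Real.log x ^ (6 / 5 : ℝ) := by
  have hlog : 0.69 ≤ Real.log x := by
    linarith [Real.log_two_gt_d9, Real.log_le_log two_pos hx]
  calc (2 / 5 : ℝ) ≤ (0.69 : ℝ) ^ (2 : ℝ) := by norm_num
    _ ≤ (0.69 : ℝ) ^ (6 / 5 : ℝ) :=
        Real.rpow_le_rpow_of_exponent_ge (by norm_num) (by norm_num) (by norm_num)
    _ ≤ Real.log x ^ (6 / 5 : ℝ) := by gcongr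

lemma one_add_mul_rpow_le_approxRatio {C : ℝ} (hC : 0 ≤ C) (hr : 2 ≤ r) (hsr : s ≤ r) :
    1 + C * ((s : ℝ) / r) ^ (1 / 3 : ℝ) ≤ approxRatio (5 / 2 * C) s r := by
  have hle : (s : ℝ) / r ≤ 1 := div_le_one_of_le₀ (Nat.cast_le.2 hsr) r.cast_nonneg
  have hroot : ((s : ℝ) / r) ^ (1 / 3 : ℝ) ≤ ((s : ℝ) / r) ^ (1 / 5 : ℝ) :=
    Real.rpow_le_rpow_of_exponent_ge' (by positivity) hle (by norm_num) (by norm_num)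
  have hlog : 1 ≤ 5 / 2 * Real.log r ^ (6 / 5 : ℝ) := by
    linarith [two_fifths_le_log_rpow (Nat.ofNat_le_cast.2 hr : (2 : ℝ) ≤ r)]
  calc 1 + C * ((s : ℝ) / r) ^ (1 / 3 : ℝ)
      ≤ 1 + C * (((s : ℝ) / r) ^ (1 / 5 : ℝ) * (5 / 2 * Real.log r ^ (6 / 5 : ℝ))) := by
        gcongr
        exact hroot.trans (le_mul_of_one_le_right (by positivity) hlog)
    _ = approxRatio (5 / 2 * C) s r := by
        rw [approxRatio]
        ring

end Approximation

end LinProphet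

end

theorem mainTheorem4_general :
    ∃ C : ℝ, 0 < C ∧ ∀ s r : ℕ, s ≤ r →
      LinProphet.AdmitsApproximation s r (1 + C * ((s : ℝ) / r) ^ (1 / 3 : ℝ)) := by
  refine ⟨5900, by norm_num, fun s r hsr => ?_⟩
  obtain rfl | hs := s.eq_zero_or_pos
  · exact LinProphet.admitsApproximation_zero r _
  have hr : (0 : ℝ) < r := Nat.cast_pos.2 (hs.trans_le hsr)
  set u : ℝ := ((s : ℝ) / r) ^ (1 / 3 : ℝ) with hu
  have hu0 : 0 ≤ u := by positivity
  have hs_eq : (s : ℝ) = u ^ 3 * r := by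
    rw [hu, ← Real.rpow_mul_natCast (by positivity)]
    norm_num [hr.ne']
  obtain hsmall | hlarge := le_or_gt u (1 / 100)
  · have hsu : (s : ℝ) ≤ u * r := hs_eq.trans_le
      (mul_le_mul_of_nonneg_right (pow_le_of_le_one hu0 (by linarith) three_ne_zero) hr.le)
    have hκ : 0 < 1 - 29 * u := by linarith
    refine (LinProphet.admitsApproximation_of_le_cube_mul (by linarith)
      ((Nat.one_le_cast.2 hs).trans hsu) hs_eq.le).mono (inv_pos.2 hκ) ?_
    rw [inv_le_iff_one_le_mul₀' hκ]
    nlinarith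
  · exact (LinProphet.admitsApproximation_sixty (hs.trans_le hsr) hsr).mono (by norm_num)
      (by linarith)

theorem mainTheorem4 :
    ∃ C : ℝ, 0 < C ∧
      (∀ s r : ℕ, 2 ≤ r → s ≤ r →
        LinProphet.AdmitsApproximation s r (LinProphet.approxRatio C s r)) ∧
      (∀ s : ℕ, Tendsto (fun r : ℕ => LinProphet.approxRatio C s r) atTop (𝓝 1)) := by
  obtain ⟨C, hC, h⟩ := mainTheorem4_general
  exact ⟨5 / 2 * C, by positivity, fun s r hr hsr => (h s r hsr).mono (by positivity)
    (LinProphet.one_add_mul_rpow_le_approxRatio hC.le hr hsr), LinProphet.tendsto_approxRatio _⟩
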